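/- Let $n\ge 3$. A real $n\times n$ matrix $H$ is called *unreduced upper Hessenberg* if $H_{ij}=0$ for $i>j+1$ and $H_{j+1,j}\neq 0$ for all $1\le j<n$. We say that $H$ *represents an acute simplex* if its columns together with the origin are the $n+1$ vertices of a nondegenerate simplex in $\mathbb{R}^n$ all of whose dihedral angles (between pairs of facets) are smaller than $\pi/2$. A real matrix $A$ is *strictly ultrametric* if it is symmetric, all its entries are positive, $A_{ij}\ge\min(A_{il},A_{lj})$ for all $i,j,l$, and $A_{ii}>A_{ij}$ for all $i\ne j$. Let $\lambda=\langle\lambda_1,\dots,\lambda_k\rangle$ be a composition of $n-1$. Divide the rows $2,\dots,n$ into consecutive strips $R_1,\dots,R_k$ of heights $\lambda_1,\dots,\lambda_k$ and put $R_0=\{1\}$; divide the columns $1,\dots,n-1$ into consecutive strips $C_1,\dots,C_k$ of widths $\lambda_1,\dots,\lambda_k$ and put $C_{k+1}=\{n\}$. The $n\times n$ block checkerboard matrix $H_\lambda$ has as its block in position $R_i\times C_j$ the identity matrix if $i=j$, the zero matrix if $i>j$, the all-ones matrix if $j-i$ is positive and odd, and the zero matrix if $j-i$ is positive and even. Call $\lambda$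 *admissible* if $\lambda_1\ge 2$ and $\lambda_k\ge 2$. **Theorem.** (1) Let $H$ be an $n\times n$ unreduced upper Hessenberg matrix with entries in $\{0,1\}$ that represents an acute simplex. Then, possibly after exchanging its first two rows and/or its last two columns, $H$ equals $H_\lambda$ for some admissible composition $\lambda$ of $n-1$. (2) For each admissible composition $\lambda$ of $n-1$, $$|\det(H_\lambda)|=f_k,\qquad\text{where}\qquad \frac{f_k}{g_k}=\lambda_1+\cfrac{1}{\lambda_2+\cfrac{1}{\ddots+\cfrac{1}{\lambda_k}}},\qquad f_k,g_k\in\mathbb{N},\ \gcd(f_k,g_k)=1.$$ (3) Consider Kepler's tree of fractions, the binary tree with root $\frac12$ (at level $0$) in which the children of $\frac pq$ are $\frac{p}{p+q}$ and $\frac{q}{p+q}$. If $n\ge 4$, then the numbers $|\det(H_\lambda)|$, with $\lambda$ ranging over the admissible compositions of $n-1$, are, counted with multiplicity, the numbers $p+q$, with $\frac pq$ ranging over the $2^{n-4}$ vertices of the tree at level $n-4$. (4) Conversely, for each admissible composition $\lambda$ of $n-1$, the matrix $H_\lambda$ is an unreduced upper Hessenberg matrix with entries in $\{0,1\}$, its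 Gramian $H_\lambda^{\top}H_\lambda$ is strictly ultrametric, and $H_\lambda$ represents an acute simplex. -/

import Mathlib

open scoped Matrix

noncomputable section

namespace AcuteHessenberg

/-! ### Dihedral angles and acute simplices -/

/-- The dihedral angle of a nondegenerate `n`-simplex between its facets opposite to the vertices
`i` and `j`: the supplement of the angle between the inward normals of these two facets. The
inward normal of a facet is the vector that points from the orthogonal projection of the opposite
vertex on that facet to this vertex. -/
def dihedralAngle {V P : Type*} [NormedAddCommGroup V] [InnerProductSpace ℝ V] [MetricSpace P]
    [NormedAddTorsor V P] {n : ℕ} [NeZero n] (S : Affine.Simplex ℝ P n) (i j : Fin (n + 1)) : ℝ :=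
  Real.pi - InnerProductGeometry.angle
    (S.points i -ᵥ S.altitudeFoot i) (S.points j -ᵥ S.altitudeFoot j)

/-- A simplex is acute if all its dihedral angles are acute. -/
def IsAcute {V P : Type*} [NormedAddCommGroup V] [InnerProductSpace ℝ V] [MetricSpace P]
    [NormedAddTorsor V P] {n : ℕ} [NeZero n] (S : Affine.Simplex ℝ P n) : Prop :=
  ∀ i j : Fin (n + 1), i ≠ j → dihedralAngle S i j < Real.pi / 2

/-- The `n + 1` points consisting of the origin and the columns of the `n × n` matrix `H`. -/
def vertices {n : ℕ} (H : Matrix (Fin n) (Fin n) ℝ) : Fin (n + 1) → EuclideanSpace ℝ (Fin n) :=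
  Fin.cons 0 fun j => WithLp.toLp 2 fun i => H i j

/-- The columns of `H` together with the origin are the `n + 1` vertices of a (nondegenerate)
simplex, and this simplex is acute. -/
def RepresentsAcuteSimplex {n : ℕ} [NeZero n] (H : Matrix (Fin n) (Fin n) ℝ) : Prop :=
  ∃ S : Affine.Simplex ℝ (EuclideanSpace ℝ (Fin n)) n, S.points = vertices H ∧ IsAcute S

/-! ### Classes of matrices -/

/-- All entries are `0` or `1`. -/
def IsZeroOne {n : ℕ} (H : Matrix (Fin n) (Fin n) ℝ) : Prop :=
  ∀ i j, H i j = 0 ∨ H i j = 1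

/-- Upper Hessenberg (zero below the first subdiagonal) and unreduced (no zero on the first
subdiagonal). -/
def IsUnreducedUpperHessenberg {n : ℕ} (H : Matrix (Fin n) (Fin n) ℝ) : Prop :=
  (∀ i j : Fin n, (j : ℕ) + 1 < i → H i j = 0) ∧ ∀ i j : Fin n, (i : ℕ) = j + 1 → H i j ≠ 0

/-- Strictly ultrametric matrices: symmetric, entrywise positive, satisfying the ultrametric
inequality, and with every diagonal entry larger than the other entries of its row. -/
structure IsStrictlyUltrametric {ι : Type*} (A : Matrix ι ι ℝ) : Prop where
  symm : ∀ i j, A i j = A j i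
  pos : ∀ i j, 0 < A i j
  ultra : ∀ i j k, min (A i k) (A k j) ≤ A i j
  diag : ∀ i j, i ≠ j → A i j < A i i

/-- `K` is obtained from `H` by possibly exchanging its first two rows and possibly exchanging its
last two columns. -/
def EqUpToSwaps {m : ℕ} (H K : Matrix (Fin (m + 1)) (Fin (m + 1)) ℝ) : Prop :=
  ∃ σ τ : Equiv.Perm (Fin (m + 1)),
    (σ = 1 ∨ σ = Equiv.swap 0 1) ∧
    (τ = 1 ∨ τ = Equiv.swap ⟨m - 1, by omega⟩ (Fin.last m)) ∧
    K = H.submatrix σ τ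

/-! ### Compositions and the matrices `H_λ` -/

/-- The first and the last part of the composition are at least `2`. -/
def Admissible {m : ℕ} (c : Composition m) : Prop :=
  2 ≤ c.blocks.headD 0 ∧ 2 ≤ c.blocks.getLastD 0

instance {m : ℕ} : DecidablePred (Admissible (m := m)) := fun c => by
  unfold Admissible; infer_instance

/-- Number of the horizontal strip that contains the row `i`: the top row is strip `0`, and the
other `m` rows are divided into strips `1, …, k` of heights `λ₁, …, λₖ`. -/
def rowStrip {m : ℕ} (c : Composition m) : Fin (m + 1) → ℕ :=
  Fin.cases 0 fun i => (c.index i : ℕ) + 1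

/-- Number of the vertical strip that contains the column `j`: the first `m` columns are divided
into strips `1, …, k` of widths `λ₁, …, λₖ`, and the last column is strip `k + 1`. -/
def colStrip {m : ℕ} (c : Composition m) : Fin (m + 1) → ℕ :=
  Fin.lastCases (c.length + 1) fun j => (c.index j : ℕ) + 1

/-- The block checkerboard matrix `H_λ` of size `n = m + 1` of a composition `λ` of `m`: the
blocks in which the numbers `r` and `s` of the horizontal and the vertical strip agree are identity
matrices that cover the first subdiagonal, the blocks below them (`r > s`) vanish, and those above
them (`r < s`) consist alternatingly of ones only (`s - r` odd) and zeros only (`s - r` even). -/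
def Hlam {m : ℕ} (c : Composition m) : Matrix (Fin (m + 1)) (Fin (m + 1)) ℝ :=
  Matrix.of fun i j =>
    if rowStrip c i = colStrip c j then (if (i : ℕ) = j + 1 then 1 else 0)
    else if rowStrip c i < colStrip c j ∧ Odd (colStrip c j - rowStrip c i) then 1 else 0

/-! ### Continued fractions and Kepler's tree -/

/-- The finite continued fraction `[a₁; a₂, …, aₖ]`. -/
def contFrac : List ℕ → ℚ
  | [] => 0
  | [a] => a
  | a :: b :: l => a + 1 / contFrac (b :: l)

/-- The vertices `p / q` of level `k` of Kepler's tree of fractions, as pairs `(p, q)`: the root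
(level `0`) is `1 / 2`, and the children of `p / q` are `p / (p + q)` and `q / (p + q)`. -/
def keplerLevel : ℕ → List (ℕ × ℕ)
  | 0 => [(1, 2)]
  | k + 1 => (keplerLevel k).flatMap fun v => [(v.1, v.1 + v.2), (v.2, v.1 + v.2)]

end AcuteHessenberg

end

/-! A simplex is acute iff the gradients of its barycentric coordinates have pairwise negative inner
products (`isAcute_iff`). Both directions rest on this. On the one hand, all triangles of vertices
are then acute (`inner_sub_sub_pos_of_dual`), so the columns of a 0/1 matrix, read as sets of rows,
meet pairwise and none contains another (`IsSpernerHessenberg`). On the other hand, a matrix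
represents an acute simplex as soon as its inverse Gramian has negative off-diagonal entries and
positive row sums, and a strictly ultrametric Gramian has such an inverse
(`IsUltrametricOn.exists_inverse`).

The combinatorial core is that such a Hessenberg matrix is determined by its first row
(`IsSpernerHessenberg.apply_eq_one_iff`). Read the first row as a two-letter word, give row `i + 1`
the letter of column `i`, and the top row the letter `false`: on and above the diagonal an entry is
1 exactly when its row and column letters differ. The matrices `Hlam c` are those whose word has run
lengths `c.blocks` followed by one closing letter (`Hlam_eq_checkerboard`); the two exchanges make
the first and last runs long enough. Conversely, the Gramian of a checkerboard matrix is 1 between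
columns with different letters and a monotone count between columns with equal letters, hence
ultrametric.

Expanding the determinant along the first column strips one letter, and a run of length `a` performs
a Euclidean step with quotient `a` (`absDet_word`). The two moves in Kepler's tree, applied to the
inverse fraction, raise its first partial quotient or put a 1 in front (`keplerLevel_eq`). -/

noncomputable section

namespace AcuteHessenberg

open scoped RealInnerProductSpace

/-! ### Acute simplices in terms of gradients of barycentric coordinates -/

section Simplex

variable {V : Type*} [NormedAddCommGroup V] [InnerProductSpace ℝ V] {n : ℕ}

/-- The vectors `q i` are the gradients of the barycentric coordinates with respect to the points
`p i`, as far as differences of these points can tell. -/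
def IsDual (p q : Fin (n + 1) → V) : Prop :=
  ∀ i j k, ⟪q i, p j - p k⟫ = (if i = j then 1 else 0) - (if i = k then 1 else 0)

lemma eq_zero_of_inner_sub_eq_zero {p : Fin (n + 1) → V}
    (hp : vectorSpan ℝ (Set.range p) = ⊤) {x : V} (hx : ∀ j k, ⟪x, p j - p k⟫ = 0) : x = 0 := by
  have hle : vectorSpan ℝ (Set.range p) ≤ (ℝ ∙ x)ᗮ := by
    rw [vectorSpan_def, Submodule.span_le]
    rintro _ ⟨_, ⟨j, rfl⟩, _, ⟨k, rfl⟩, rfl⟩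
    exact Submodule.mem_orthogonal_singleton_iff_inner_right.2 (hx j k)
  rw [hp] at hle
  exact inner_self_eq_zero.1
    (Submodule.mem_orthogonal_singleton_iff_inner_right.1 (hle (Submodule.mem_top (x := x))))

/-- Pairing a vanishing weighted combination with `q i` isolates the weight of `p i`. -/
lemma IsDual.affineIndependent {p q : Fin (n + 1) → V} (h : IsDual p q) :
    AffineIndependent ℝ p := by
  rw [affineIndependent_iff_of_fintype]
  intro w hw hs i
  have h1 := Finset.weightedVSub_eq_weightedVSubOfPoint_of_sum_eq_zero Finset.univ w p hw (p 0)
  rw [hs, Finset.weightedVSubOfPoint_apply] at h1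
  have h2 := congrArg (fun x => ⟪q i, x⟫) h1
  simp only [inner_zero_right, inner_sum, inner_smul_right, vsub_eq_sub, h i, mul_sub,
    Finset.sum_sub_distrib, ← Finset.sum_mul, hw] at h2
  simpa using h2.symm

lemma IsDual.eq {p q q' : Fin (n + 1) → V} (hp : vectorSpan ℝ (Set.range p) = ⊤)
    (h : IsDual p q) (h' : IsDual p q') : q = q' := by
  funext i
  refine sub_eq_zero.1 (eq_zero_of_inner_sub_eq_zero hp fun j k => ?_)
  rw [inner_sub_left, h i, h' i, sub_self]

/-- The inward normals, scaled to the reciprocals of the heights. -/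
lemma isDual_altitude [NeZero n] (S : Affine.Simplex ℝ V n) :
    IsDual S.points fun i => (S.height i ^ 2)⁻¹ • (S.points i -ᵥ S.altitudeFoot i) := by
  intro i j k
  have key : ∀ j, ⟪S.points i -ᵥ S.altitudeFoot i, S.points i - S.points j⟫
      = S.height i ^ 2 * (1 - if i = j then 1 else 0) := by
    intro j
    by_cases hij : i = j
    · simp [hij]
    · rw [real_inner_comm, if_neg hij, sub_zero, mul_one]
      exact S.inner_vsub_vsub_altitudeFoot_eq_height_sq hij
  have h0 : S.height i ^ 2 ≠ 0 := (pow_pos (S.height_pos i) 2).ne'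
  have h1 : S.points j - S.points k
      = (S.points i - S.points k) - (S.points i - S.points j) := by abel
  rw [inner_smul_left, h1, inner_sub_right, key, key, ← mul_sub, RCLike.conj_to_real,
    inv_mul_cancel_left₀ h0]
  ring

lemma dihedralAngle_lt_iff [NeZero n] (S : Affine.Simplex ℝ V n) (i j : Fin (n + 1)) :
    dihedralAngle S i j < Real.pi / 2 ↔
      ⟪S.points i -ᵥ S.altitudeFoot i, S.points j -ᵥ S.altitudeFoot j⟫ < 0 := by
  have h1 : dihedralAngle S i j < Real.pi / 2 ↔ ¬ InnerProductGeometry.angle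
      (S.points i -ᵥ S.altitudeFoot i) (S.points j -ᵥ S.altitudeFoot j) ≤ Real.pi / 2 := by
    unfold dihedralAngle
    constructor
    · intro h h'
      linarith
    · intro h
      linarith [not_le.1 h]
  have hpos : ∀ i, 0 < ‖S.points i -ᵥ S.altitudeFoot i‖ := fun i =>
    norm_pos_iff.2 (vsub_ne_zero.2 (S.ne_altitudeFoot i))
  rw [h1, InnerProductGeometry.angle, Real.arccos_le_pi_div_two, not_le,
    div_lt_iff₀ (mul_pos (hpos i) (hpos j)), zero_mul]

/-- Dual families are unique, so `q` consists of positive multiples of the altitude vectors, and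
signs of inner products survive the scaling. -/
lemma isAcute_iff [NeZero n] (S : Affine.Simplex ℝ V n)
    (hS : vectorSpan ℝ (Set.range S.points) = ⊤) {q : Fin (n + 1) → V} (hq : IsDual S.points q) :
    IsAcute S ↔ ∀ i j, i ≠ j → ⟪q i, q j⟫ < 0 := by
  rw [hq.eq hS (isDual_altitude S)]
  refine forall₂_congr fun i j => imp_congr_right fun _ => ?_
  have hi := inv_pos.2 (pow_pos (S.height_pos i) 2)
  have hj := inv_pos.2 (pow_pos (S.height_pos j) 2)
  rw [dihedralAngle_lt_iff, inner_smul_left, inner_smul_right, RCLike.conj_to_real,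
    ← mul_assoc, ← smul_eq_mul, smul_neg_iff_of_pos_left (mul_pos hi hj)]

/-- All triangles spanned by vertices of an acute simplex are acute. -/
lemma inner_sub_sub_pos_of_dual {p q : Fin (n + 1) → V} (hp : vectorSpan ℝ (Set.range p) = ⊤)
    (hq : IsDual p q) (hneg : ∀ i j, i ≠ j → ⟪q i, q j⟫ < 0) {a b c : Fin (n + 1)}
    (hac : a ≠ c) (hbc : b ≠ c) : 0 < ⟪p a - p c, p b - p c⟫ := by
  set w := p a - p c with hw
  have hpa : p a ≠ p c := fun h => by
    have := hq a a c
    rw [h, sub_self, inner_zero_right, if_pos rfl, if_neg hac] at this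
    norm_num at this
  -- Minimum principle for `f v = ⟪w, p v - p c⟫`, the coefficients of `w` in the gradients. Since
  -- `f c = 0`, the claim is that the minimum is attained only at `c`.
  have hexp : w = ∑ v, ⟪w, p v - p c⟫ • q v := by
    refine sub_eq_zero.1 (eq_zero_of_inner_sub_eq_zero hp fun j k => ?_)
    rw [inner_sub_left, sum_inner]
    simp only [inner_smul_left, RCLike.conj_to_real, hq _ j k, mul_sub, mul_ite, mul_one, mul_zero,
      Finset.sum_sub_distrib, Finset.sum_ite_eq', Finset.mem_univ, if_true]
    rw [← inner_sub_right, sub_sub_sub_cancel_right, sub_self]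
  have hsum : ∑ v, q v = 0 := by
    refine eq_zero_of_inner_sub_eq_zero hp fun j k => ?_
    simp [sum_inner, hq _ j k, Finset.sum_sub_distrib]
  have hmin : ∀ i, i ≠ c → ∃ v, ⟪w, p v - p c⟫ < ⟪w, p i - p c⟫ := by
    intro i hi
    by_contra! hmin
    -- At a minimum `i ≠ c` every term on the right is nonpositive, while the left side is 0 or 1.
    -- So all terms vanish, `f` is constant, and `‖w‖² = f a = f c = 0`.
    have h1 : ⟪q i, w⟫ = ∑ v, (⟪w, p v - p c⟫ - ⟪w, p i - p c⟫) * ⟪q i, q v⟫ := by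
      conv_lhs => rw [hexp]
      simp only [inner_sum, inner_smul_right, sub_mul, Finset.sum_sub_distrib, ← Finset.mul_sum]
      rw [← inner_sum, hsum, inner_zero_right, mul_zero, sub_zero]
    have h2 : 0 ≤ ⟪q i, w⟫ := by
      rw [hw, hq i a c, if_neg hi]
      split_ifs <;> norm_num
    have h3 : ∀ v ∈ Finset.univ, (⟪w, p v - p c⟫ - ⟪w, p i - p c⟫) * ⟪q i, q v⟫ ≤ 0 := by
      intro v _
      by_cases hv : i = v
      · simp [hv]
      · exact mul_nonpos_of_nonneg_of_nonpos (sub_nonneg.2 (hmin v)) (hneg i v hv).le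
    have h4 := (Finset.sum_eq_zero_iff_of_nonpos h3).1
      (le_antisymm (Finset.sum_nonpos h3) (h1 ▸ h2))
    have h5 : ∀ v, ⟪w, p v - p c⟫ = ⟪w, p i - p c⟫ := by
      intro v
      by_cases hv : i = v
      · rw [hv]
      · exact sub_eq_zero.1 ((mul_eq_zero.1 (h4 v (Finset.mem_univ v))).resolve_right
          (hneg i v hv).ne)
    have h6 := (h5 a).trans (h5 c).symm
    rw [sub_self, inner_zero_right, ← hw, inner_self_eq_zero, hw, sub_eq_zero] at h6
    exact hpa h6
  obtain ⟨i, -, hi⟩ := Finset.exists_min_image Finset.univ (fun v => ⟪w, p v - p c⟫)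
    Finset.univ_nonempty
  have hic : i = c := by
    by_contra h
    obtain ⟨v, hv⟩ := hmin i h
    exact (hi v (Finset.mem_univ v)).not_gt hv
  obtain ⟨v, hv⟩ := hmin b hbc
  have := hi v (Finset.mem_univ v)
  rw [hic, sub_self, inner_zero_right] at this
  exact this.trans_lt hv

end Simplex

/-! ### Acuteness of the simplex of a matrix in terms of its Gramian -/

lemma vectorSpan_points_eq_top {n : ℕ} (S : Affine.Simplex ℝ (EuclideanSpace ℝ (Fin n)) n) :
    vectorSpan ℝ (Set.range S.points) = ⊤ :=
  S.independent.vectorSpan_eq_top_of_card_eq_finrank_add_one (by simp)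

lemma inner_toLp {n : ℕ} (H : Matrix (Fin n) (Fin n) ℝ) (K : Matrix (Fin n) (Fin n) ℝ)
    (i j : Fin n) :
    ⟪(WithLp.toLp 2 fun r => H r i : EuclideanSpace ℝ (Fin n)), WithLp.toLp 2 fun r => K r j⟫
      = (Hᵀ * K) i j := by
  simp [PiLp.inner_apply, Matrix.mul_apply, mul_comm]

/-- The edges of the acute simplex at the origin make acute angles with each other and with the
opposite edges. -/
lemma RepresentsAcuteSimplex.gram {n : ℕ} [NeZero n] {H : Matrix (Fin n) (Fin n) ℝ}
    (h : RepresentsAcuteSimplex H) {i j : Fin n} (hij : i ≠ j) :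
    0 < (Hᵀ * H) i j ∧ (Hᵀ * H) i j < (Hᵀ * H) i i := by
  obtain ⟨S, hS, hacute⟩ := h
  have hspan := vectorSpan_points_eq_top S
  have hq := isDual_altitude S
  have hneg := (isAcute_iff S hspan hq).1 hacute
  have hsucc : ∀ k : Fin n, S.points k.succ = WithLp.toLp 2 fun r => H r k := by
    intro k
    rw [hS]
    simp [vertices]
  have hzero : S.points 0 = 0 := by
    rw [hS]
    simp [vertices]
  have h1 := inner_sub_sub_pos_of_dual hspan hq hneg
    (Fin.succ_ne_zero i) (Fin.succ_ne_zero j)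
  have h2 := inner_sub_sub_pos_of_dual hspan hq hneg (Fin.succ_ne_zero i).symm
    (fun h => hij (Fin.succ_injective _ h).symm : j.succ ≠ i.succ)
  rw [hzero, sub_zero, sub_zero, hsucc, hsucc, inner_toLp] at h1
  rw [hzero, zero_sub, inner_neg_left, inner_sub_right, hsucc, hsucc, inner_toLp, inner_toLp] at h2
  exact ⟨h1, by linarith⟩

/-- A matrix represents an acute simplex if its Gramian has a strictly diagonally dominant inverse
with negative off-diagonal entries. -/
lemma representsAcuteSimplex_of_gram_inverse {n : ℕ} [NeZero n] {H B : Matrix (Fin n) (Fin n) ℝ}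
    (hB : (Hᵀ * H) * B = 1) (hoff : ∀ i j, i ≠ j → B i j < 0) (hrow : ∀ i, 0 < ∑ j, B i j) :
    RepresentsAcuteSimplex H := by
  have hinv : Hᵀ * (H * B) = 1 := by rw [← Matrix.mul_assoc, hB]
  have hinv' : (H * B)ᵀ * H = 1 := by
    rw [← Matrix.transpose_one, ← hinv, Matrix.transpose_mul Hᵀ, Matrix.transpose_transpose]
  have hsq : (H * B)ᵀ * (H * B) = B := by
    rw [← Matrix.mul_assoc, hinv', Matrix.one_mul]
  set Q := H * B
  let c : Fin n → EuclideanSpace ℝ (Fin n) := fun j => WithLp.toLp 2 fun r => Q r j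
  -- The columns of `H * B` are dual to those of `H`. Barycentric coordinates sum to 1, so the
  -- gradient at the origin is minus the sum of the others; its products with them are minus the row
  -- sums of `B`.
  let q : Fin (n + 1) → EuclideanSpace ℝ (Fin n) := Fin.cons (-∑ j, c j) c
  have hcp : ∀ i j : Fin n, ⟪c i, vertices H j.succ⟫ = if i = j then 1 else 0 := by
    intro i j
    have := inner_toLp Q H i j
    rw [hinv', Matrix.one_apply] at this
    simpa [vertices, c] using this
  have hcc : ∀ i j, ⟪c i, c j⟫ = B i j := fun i j => (inner_toLp Q Q i j).trans (by rw [hsq])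
  have hcp' : ∀ (i : Fin n) (j : Fin (n + 1)),
      ⟪c i, vertices H j⟫ = if i.succ = j then 1 else 0 := by
    intro i j
    refine Fin.cases ?_ (fun j => ?_) j
    · simp [vertices]
    · simp [hcp]
  have hq : IsDual (vertices H) q := by
    intro i j k
    rw [inner_sub_right]
    refine Fin.cases ?_ (fun i => ?_) i
    · have hsum : ∀ j : Fin (n + 1), ∑ i : Fin n, (if i.succ = j then (1 : ℝ) else 0)
          = 1 - if 0 = j then 1 else 0 := by
        intro j
        have := Fin.sum_univ_succ fun i : Fin (n + 1) => if i = j then (1 : ℝ) else 0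
        rw [Finset.sum_ite_eq' Finset.univ j] at this
        simp only [Finset.mem_univ, if_true] at this
        linarith
      simp only [q, Fin.cons_zero, inner_neg_left, sum_inner, hcp', hsum]
      ring
    · simp only [q, Fin.cons_succ, hcp']
  let S : Affine.Simplex ℝ (EuclideanSpace ℝ (Fin n)) n := ⟨vertices H, hq.affineIndependent⟩
  refine ⟨S, rfl, (isAcute_iff S (vectorSpan_points_eq_top S) hq).2 ?_⟩
  have hzero : ∀ j, ⟪q 0, c j⟫ < 0 := by
    intro j
    rw [real_inner_comm]
    simp only [q, Fin.cons_zero, inner_neg_right, inner_sum, neg_lt_zero, hcc]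
    exact hrow j
  intro i j
  refine Fin.cases (Fin.cases ?_ (fun j => ?_) j) (fun i => Fin.cases ?_ (fun j => ?_) j) i
  · simp
  · exact fun _ => hzero j
  · exact fun _ => real_inner_comm (q 0) (c i) ▸ hzero i
  · intro hij
    exact (hcc i j).trans_lt (hoff i j fun h => hij (congrArg Fin.succ h))

/-! ### Inverses of ultrametric matrices -/

section Ultrametric

variable {ι : Type*}

/-- Nonnegative ultrametric matrices on a finite index set, with a positive diagonal that strictly
dominates the other entries. -/
structure IsUltrametricOn (S : Finset ι) (A : ι → ι → ℝ) : Prop where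
  symm : ∀ i ∈ S, ∀ j ∈ S, A i j = A j i
  nonneg : ∀ i ∈ S, ∀ j ∈ S, 0 ≤ A i j
  ultra : ∀ i ∈ S, ∀ j ∈ S, ∀ k ∈ S, min (A i k) (A k j) ≤ A i j
  diag : ∀ i ∈ S, 0 < A i i
  offdiag : ∀ i ∈ S, ∀ j ∈ S, i ≠ j → A i j < A i i

lemma IsUltrametricOn.mono {S T : Finset ι} {A : ι → ι → ℝ} (h : IsUltrametricOn S A)
    (hT : T ⊆ S) : IsUltrametricOn T A where
  symm i hi j hj := h.symm i (hT hi) j (hT hj)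
  nonneg i hi j hj := h.nonneg i (hT hi) j (hT hj)
  ultra i hi j hj k hk := h.ultra i (hT hi) j (hT hj) k (hT hk)
  diag i hi := h.diag i (hT hi)
  offdiag i hi j hj := h.offdiag i (hT hi) j (hT hj)

variable [DecidableEq ι]

/-- `B` is an inverse of `A` on `S` that is a symmetric strictly diagonally dominant matrix with
nonpositive off-diagonal entries. -/
structure IsStieltjesInverseOn (S : Finset ι) (A B : ι → ι → ℝ) : Prop where
  symm : ∀ i j, B i j = B j i
  support : ∀ i j, i ∉ S → B i j = 0
  mul_eq : ∀ i ∈ S, ∀ j ∈ S, ∑ k ∈ S, A i k * B k j = if i = j then 1 else 0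
  offdiag : ∀ i j, i ≠ j → B i j ≤ 0
  rowSum : ∀ i ∈ S, 0 < ∑ j ∈ S, B i j

/-- Inverses of the diagonal blocks of a block diagonal matrix combine to an inverse. -/
lemma IsStieltjesInverseOn.union {S T : Finset ι} {A B C : ι → ι → ℝ} (hST : Disjoint S T)
    (hA : ∀ i ∈ S, ∀ j ∈ T, A i j = 0) (hA' : ∀ i ∈ T, ∀ j ∈ S, A i j = 0)
    (hB : IsStieltjesInverseOn S A B) (hC : IsStieltjesInverseOn T A C) :
    IsStieltjesInverseOn (S ∪ T) A fun i j => B i j + C i j := by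
  have hnT : ∀ i ∈ S, i ∉ T := fun _ h => Finset.disjoint_left.1 hST h
  have hnS : ∀ i ∈ T, i ∉ S := fun _ h => Finset.disjoint_right.1 hST h
  have hBT : ∀ i, ∀ j ∈ T, B i j = 0 := fun i j hj =>
    (hB.symm i j).trans (hB.support j i (hnS j hj))
  have hCS : ∀ i, ∀ j ∈ S, C i j = 0 := fun i j hj =>
    (hC.symm i j).trans (hC.support j i (hnT j hj))
  have hBT' : ∀ i ∈ T, ∀ j, B i j = 0 := fun i hi j => hB.support i j (hnS i hi)
  have hCS' : ∀ i ∈ S, ∀ j, C i j = 0 := fun i hi j => hC.support i j (hnT i hi)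
  refine ⟨fun i j => by rw [hB.symm, hC.symm], fun i j hi => ?_, fun i hi j hj => ?_,
    fun i j hij => add_nonpos (hB.offdiag i j hij) (hC.offdiag i j hij), fun i hi => ?_⟩
  · rw [Finset.mem_union, not_or] at hi
    rw [hB.support i j hi.1, hC.support i j hi.2, add_zero]
  · rw [Finset.sum_union hST]
    have h1 : ∑ k ∈ S, A i k * (B k j + C k j) = ∑ k ∈ S, A i k * B k j :=
      Finset.sum_congr rfl fun k hk => by rw [hCS' k hk, add_zero]
    have h2 : ∑ k ∈ T, A i k * (B k j + C k j) = ∑ k ∈ T, A i k * C k j :=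
      Finset.sum_congr rfl fun k hk => by rw [hBT' k hk, zero_add]
    rw [h1, h2]
    rcases Finset.mem_union.1 hi with hi | hi
    · rw [Finset.sum_eq_zero (s := T) fun k hk => by rw [hA i hi k hk, zero_mul], add_zero]
      rcases Finset.mem_union.1 hj with hj | hj
      · exact hB.mul_eq i hi j hj
      · rw [if_neg fun h : i = j => hnT i hi (h ▸ hj)]
        exact Finset.sum_eq_zero fun k _ => by rw [hBT k j hj, mul_zero]
    · rw [Finset.sum_eq_zero (s := S) fun k hk => by rw [hA' i hi k hk, zero_mul], zero_add]
      rcases Finset.mem_union.1 hj with hj | hj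
      · rw [if_neg fun h : i = j => hnT j hj (h ▸ hi)]
        exact Finset.sum_eq_zero fun k _ => by rw [hCS k j hj, mul_zero]
      · exact hC.mul_eq i hi j hj
  · rw [Finset.sum_union hST, Finset.sum_add_distrib, Finset.sum_add_distrib,
      Finset.sum_eq_zero fun k hk => hCS i k hk, Finset.sum_eq_zero fun k hk => hBT i k hk,
      add_zero, zero_add]
    rcases Finset.mem_union.1 hi with hi | hi
    · rw [Finset.sum_eq_zero (s := T) fun k _ => hCS' i hi k, add_zero]
      exact hB.rowSum i hi
    · rw [Finset.sum_eq_zero (s := S) fun k _ => hBT' i hi k, zero_add]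
      exact hC.rowSum i hi

/-- Adding a nonnegative constant to all entries of a matrix preserves the existence of an inverse
that is a strictly diagonally dominant Stieltjes matrix (by the Sherman-Morrison formula). -/
lemma IsStieltjesInverseOn.add_const {S : Finset ι} {A B : ι → ι → ℝ} {t : ℝ} (ht : 0 ≤ t)
    (hB : IsStieltjesInverseOn S A B) :
    ∃ C, IsStieltjesInverseOn S (fun i j => A i j + t) C ∧
      (0 < t → ∀ i ∈ S, ∀ j ∈ S, i ≠ j → C i j < 0) := by
  set b : ι → ℝ := fun i => ∑ j ∈ S, B i j with hb
  set s : ℝ := ∑ i ∈ S, b i with hs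
  have hs0 : 0 ≤ s := Finset.sum_nonneg fun i hi => (hB.rowSum i hi).le
  have hd : 0 < 1 + t * s := by positivity
  -- The rank-one update is `B - c b bᵀ` with `b = B 1` and `s = 1ᵀ B 1`; its row sums are `b i / (1
  -- + t * s)`.
  set c : ℝ := t / (1 + t * s) with hc
  have hc0 : 0 ≤ c := by positivity
  have hcs : t - c - t * (c * s) = 0 := by
    rw [hc]
    field_simp
    ring
  have hb0 : ∀ i, 0 ≤ b i := by
    intro i
    by_cases hi : i ∈ S
    · exact (hB.rowSum i hi).le
    · exact (Finset.sum_eq_zero fun j _ => hB.support i j hi).ge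
  have hcol : ∀ j, ∑ k ∈ S, B k j = b j := fun j =>
    Finset.sum_congr rfl fun k _ => hB.symm k j
  have hAb : ∀ i ∈ S, ∑ k ∈ S, A i k * b k = 1 := by
    intro i hi
    simp only [hb, Finset.mul_sum]
    rw [Finset.sum_comm, Finset.sum_congr rfl fun j hj => hB.mul_eq i hi j hj]
    simp [hi]
  refine ⟨fun i j => B i j - c * (b i * b j), ⟨fun i j => ?_, fun i j hi => ?_,
    fun i hi j hj => ?_, fun i j hij => ?_, fun i hi => ?_⟩, fun ht i hi j hj hij => ?_⟩
  · rw [hB.symm i j, mul_comm (b i)]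
  · have : b i = 0 := Finset.sum_eq_zero fun j _ => hB.support i j hi
    rw [hB.support i j hi, this, zero_mul, mul_zero, sub_zero]
  · have : ∀ k, (A i k + t) * (B k j - c * (b k * b j))
        = A i k * B k j - c * b j * (A i k * b k) + t * B k j - t * c * b j * b k := fun k => by
      ring
    simp only [this, Finset.sum_add_distrib, Finset.sum_sub_distrib, ← Finset.mul_sum]
    rw [hB.mul_eq i hi j hj, hAb i hi, hcol, ← hs]
    linear_combination b j * hcs
  · have := mul_nonneg hc0 (mul_nonneg (hb0 i) (hb0 j))
    linarith [hB.offdiag i j hij]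
  · rw [Finset.sum_sub_distrib, ← Finset.mul_sum, ← Finset.mul_sum]
    change 0 < b i - c * (b i * s)
    have : b i - c * (b i * s) = b i / (1 + t * s) := by
      rw [hc]
      field_simp
      ring
    rw [this]
    exact div_pos (hB.rowSum i hi) hd
  · have : 0 < c * (b i * b j) :=
      mul_pos (div_pos ht hd) (mul_pos (hB.rowSum i hi) (hB.rowSum j hj))
    linarith [hB.offdiag i j hij]

/-- Subtracting the minimal entry `t` leaves a nonnegative ultrametric matrix with a zero entry,
which the ultrametric inequality splits into two diagonal blocks. These are inverted by induction
and `t` is added back; if `t > 0`, the rank-one update makes all off-diagonal entries strictly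
negative. Zero entries must be allowed for the induction to run. -/
lemma IsUltrametricOn.exists_inverse {S : Finset ι} {A : ι → ι → ℝ} (hA : IsUltrametricOn S A) :
    ∃ B, IsStieltjesInverseOn S A B ∧
      ((∀ i ∈ S, ∀ j ∈ S, 0 < A i j) → ∀ i ∈ S, ∀ j ∈ S, i ≠ j → B i j < 0) := by
  induction S using Finset.strongInduction generalizing A with
  | H S ih =>
    rcases S.eq_empty_or_nonempty with rfl | hne
    · exact ⟨fun _ _ => 0, ⟨by simp, by simp, by simp, by simp, by simp⟩, by simp⟩
    -- A singleton is a base case: subtracting the minimum would annihilate its only diagonal entry.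
    by_cases hcard : ∃ i, S = {i}
    · obtain ⟨i, rfl⟩ := hcard
      have hi := hA.diag i (Finset.mem_singleton_self i)
      refine ⟨fun j k => if j = i ∧ k = i then (A i i)⁻¹ else 0, ⟨fun j k => ?_, fun j k hj => ?_,
        ?_, fun j k hjk => ?_, ?_⟩, fun _ j hj k hk hjk => ?_⟩
      · simp only [and_comm]
      · rw [if_neg fun h => hj (Finset.mem_singleton.2 h.1)]
      · simp [hi.ne']
      · rw [if_neg fun h => hjk (h.1.trans h.2.symm)]
      · simpa using hi
      · exact absurd ((Finset.mem_singleton.1 hj).trans (Finset.mem_singleton.1 hk).symm) hjk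
    obtain ⟨⟨a, b⟩, hab, hmin⟩ := Finset.exists_min_image (S ×ˢ S) (fun x => A x.1 x.2)
      (hne.product hne)
    rw [Finset.mem_product] at hab
    obtain ⟨ha, hb⟩ := hab
    replace hmin : ∀ i ∈ S, ∀ j ∈ S, A a b ≤ A i j := fun i hi j hj =>
      hmin (i, j) (Finset.mem_product.2 ⟨hi, hj⟩)
    have hlt : ∀ i ∈ S, A a b < A i i := by
      intro i hi
      obtain ⟨j, hj, hji⟩ : ∃ j ∈ S, j ≠ i := by
        by_contra! h
        exact hcard ⟨i, Finset.eq_singleton_iff_unique_mem.2 ⟨hi, h⟩⟩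
      exact (hmin i hi j hj).trans_lt (hA.offdiag i hi j hj hji.symm)
    set t := A a b with ht
    set A' : ι → ι → ℝ := fun i j => A i j - t with hA'
    have hU : IsUltrametricOn S A' := by
      refine ⟨fun i hi j hj => ?_, fun i hi j hj => sub_nonneg.2 (hmin i hi j hj),
        fun i hi j hj k hk => ?_, fun i hi => sub_pos.2 (hlt i hi),
        fun i hi j hj hij => sub_lt_sub_right (hA.offdiag i hi j hj hij) t⟩
      · simp only [hA', hA.symm i hi j hj]
      · simp only [hA', min_sub_sub_right]
        exact sub_le_sub_right (hA.ultra i hi j hj k hk) t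
    -- Both parts are proper subsets: `b` is not in `S₁` because `A' a b = 0`, and `a` is not in
    -- `S₂`.
    set S₁ := S.filter fun j => 0 < A' a j with hS₁
    set S₂ := S.filter fun j => ¬ 0 < A' a j with hS₂
    have hunion : S₁ ∪ S₂ = S := Finset.filter_union_filter_not_eq _ S
    have hdisj : Disjoint S₁ S₂ := Finset.disjoint_filter_filter_not S S _
    have hz : ∀ i ∈ S₁, ∀ j ∈ S₂, A' i j = 0 := by
      intro i hi j hj
      rw [hS₁, Finset.mem_filter] at hi
      rw [hS₂, Finset.mem_filter] at hj
      refine le_antisymm ?_ (hU.nonneg i hi.1 j hj.1)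
      by_contra! h
      exact hj.2 ((lt_min hi.2 h).trans_le (hU.ultra a ha j hj.1 i hi.1))
    have hz' : ∀ i ∈ S₂, ∀ j ∈ S₁, A' i j = 0 := fun i hi j hj =>
      (hU.symm i (Finset.mem_of_mem_filter i hi) j (Finset.mem_of_mem_filter j hj)).trans
        (hz j hj i hi)
    have h1 : S₁ ⊂ S := Finset.filter_ssubset.2 ⟨b, hb, by simp [hA', ht]⟩
    have h2 : S₂ ⊂ S := Finset.filter_ssubset.2 ⟨a, ha, not_not.2 (hU.diag a ha)⟩
    obtain ⟨B₁, hB₁, -⟩ := ih S₁ h1 (hU.mono h1.subset)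
    obtain ⟨B₂, hB₂, -⟩ := ih S₂ h2 (hU.mono h2.subset)
    have hB := hB₁.union hdisj hz hz' hB₂
    rw [hunion] at hB
    obtain ⟨C, hC, hneg⟩ := hB.add_const (hA.nonneg a ha b hb)
    simp only [hA', ht, sub_add_cancel] at hC
    exact ⟨C, hC, fun hpos => hneg (hpos a ha b hb)⟩

end Ultrametric

lemma representsAcuteSimplex_of_isStrictlyUltrametric {n : ℕ} [NeZero n]
    {H : Matrix (Fin n) (Fin n) ℝ} (h : IsStrictlyUltrametric (Hᵀ * H)) :
    RepresentsAcuteSimplex H := by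
  have hU : IsUltrametricOn Finset.univ (Hᵀ * H) :=
    ⟨fun i _ j _ => h.symm i j, fun i _ j _ => (h.pos i j).le, fun i _ j _ k _ => h.ultra i j k,
      fun i _ => h.pos i i, fun i _ j _ => h.diag i j⟩
  obtain ⟨B, hB, hneg⟩ := hU.exists_inverse
  refine representsAcuteSimplex_of_gram_inverse (B := Matrix.of B) ?_
    (fun i j hij => hneg (fun i _ j _ => h.pos i j) i (Finset.mem_univ i) j (Finset.mem_univ j) hij)
    fun i => hB.rowSum i (Finset.mem_univ i)
  ext i j
  rw [Matrix.mul_apply, Matrix.one_apply]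
  exact hB.mul_eq i (Finset.mem_univ i) j (Finset.mem_univ j)

/-! ### Checkerboard matrices of words -/

/-- The word with `b` put in front. -/
def prev (b : Bool) (h : ℕ → Bool) : ℕ → Bool
  | 0 => b
  | i + 1 => h i

/-- The upper Hessenberg matrix of size `n` with ones on the first subdiagonal in which, on and
above the diagonal, each row marks the columns whose letters differ from the letter of that row:
the top row has the letter `b`, and the rows below have the letters `h 0, h 1, …`. -/
def checkerboard (n : ℕ) (b : Bool) (h : ℕ → Bool) : Matrix (Fin n) (Fin n) ℝ :=
  Matrix.of fun i j =>
    if (i : ℕ) = j + 1 then 1 else if (i : ℕ) ≤ j ∧ h j ≠ prev b h i then 1 else 0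

lemma checkerboard_congr {n : ℕ} {b : Bool} {h h' : ℕ → Bool} (hh : ∀ j < n, h j = h' j) :
    checkerboard n b h = checkerboard n b h' := by
  have hp : ∀ i < n, prev b h i = prev b h' i := by
    intro i hi
    cases i with
    | zero => rfl
    | succ i => exact hh i (by omega)
  ext i j
  simp only [checkerboard, Matrix.of_apply, hh j j.2, hp i i.2]

/-- The word in which the letters alternate after runs of the given lengths; it ends with a single
letter after the last run. -/
def word (b : Bool) : List ℕ → List Bool
  | [] => [b]
  | a :: l => List.replicate a b ++ word (!b) l

lemma length_word (b : Bool) (l : List ℕ) : (word b l).length = l.sum + 1 := by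
  induction l generalizing b with
  | nil => rfl
  | cons a l ih => simp [word, ih, add_assoc]

lemma word_ne_nil (b : Bool) (l : List ℕ) : word b l ≠ [] :=
  List.ne_nil_of_length_pos (by rw [length_word]; omega)

lemma word_getD_sum (b : Bool) (l : List ℕ) :
    (word b l).getD l.sum false = (b ^^ l.length.bodd) := by
  induction l generalizing b with
  | nil => simp [word]
  | cons a l ih =>
    rw [word, List.sum_cons, List.getD_append_right _ _ _ _ (by simp), List.length_replicate,
      Nat.add_sub_cancel_left, ih, List.length_cons, Nat.bodd_succ]
    cases b <;> cases l.length.bodd <;> rfl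

lemma word_getD (b : Bool) (l : List ℕ) (k j : ℕ) (h1 : (l.take k).sum ≤ j)
    (h2 : j < (l.take (k + 1)).sum) : (word b l).getD j false = (b ^^ k.bodd) := by
  induction l generalizing b k j with
  | nil => simp at h2
  | cons a l ih =>
    cases k with
    | zero =>
      have hj : j < a := by simpa using h2
      rw [word, List.getD_append _ _ _ _ (by simpa using hj), List.getD_replicate _ hj]
      simp
    | succ k =>
      rw [List.take_succ_cons, List.sum_cons] at h1 h2
      rw [word, List.getD_append_right _ _ _ _ (by rw [List.length_replicate]; omega),
        List.length_replicate, ih (!b) k (j - a) (by omega) (by omega), Nat.bodd_succ]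
      cases b <;> cases k.bodd <;> rfl

/-- Run-length encoding of `h 0, …, h m`, where the last letter differs from its predecessor and is
not counted as a run. Stripping the first letter shortens the first run or removes a run of length
1. The last two clauses provide admissibility. -/
lemma exists_word (m : ℕ) (h : ℕ → Bool) (hlast : ∀ r, m = r + 1 → h m ≠ h r) :
    ∃ l : List ℕ, (∀ a ∈ l, 0 < a) ∧ l.sum = m ∧ (∀ j ≤ m, (word (h 0) l).getD j false = h j) ∧
      (2 ≤ m → h 0 = h 1 → 2 ≤ l.headD 0) ∧
      ∀ r, m = r + 2 → h r = h (r + 1) → 2 ≤ l.getLastD 0 := by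
  induction m generalizing h with
  | zero => exact ⟨[], by simp, rfl, by simp [word], by simp, by simp⟩
  | succ m ih =>
    obtain ⟨l, hpos, hsum, hget, -, hl⟩ := ih (fun j => h (j + 1))
      (fun r hr => by subst hr; exact hlast _ rfl)
    cases l with
    | nil =>
      obtain rfl : m = 0 := by simpa using hsum.symm
      refine ⟨[1], by simp, rfl, fun j hj => ?_, by simp, by simp⟩
      have h10 : h 1 ≠ h 0 := hlast 0 rfl
      interval_cases j
      · simp [word]
      · simpa [word] using (Bool.eq_not_of_ne h10).symm
    | cons a l =>
      have ha : 0 < a := hpos a (by simp)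
      rw [List.sum_cons] at hsum
      by_cases h01 : h 0 = h 1
      · refine ⟨(a + 1) :: l, ?_, by simp; omega, fun j hj => ?_, fun _ _ => by simp; omega, ?_⟩
        · intro x hx
          rcases List.mem_cons.1 hx with rfl | hx
          · omega
          · exact hpos x (by simp [hx])
        · cases j with
          | zero => simp [word, List.replicate_succ]
          | succ j =>
            have := hget j (by omega)
            rw [zero_add, ← h01] at this
            simpa [word, List.replicate_succ] using this
        · intro r hr hr'
          cases l with
          | nil => simp; omega
          | cons c l =>
            have hl' := hl (r - 1)
            rcases r with _ | r
            · have := hpos c (by simp)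
              simp only [List.sum_cons] at hsum
              omega
            · simpa using hl' (by omega) hr'
      · refine ⟨1 :: a :: l, ?_, by simp; omega, fun j hj => ?_, fun _ h => absurd h h01, ?_⟩
        · intro x hx
          rcases List.mem_cons.1 hx with rfl | hx
          · omega
          · exact hpos x hx
        · cases j with
          | zero => simp [word]
          | succ j =>
            have := hget j (by omega)
            rw [zero_add, Bool.eq_not_of_ne (Ne.symm h01)] at this
            simpa [word] using this
        · intro r hr hr'
          rcases r with _ | r
          · exact absurd hr' h01
          · simpa using hl r (by omega) hr'

lemma odd_iff_bodd (n : ℕ) : Odd n ↔ n.bodd = true := by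
  rw [Nat.odd_iff, Nat.mod_two_of_bodd]
  cases n.bodd <;> simp

/-! ### The matrices `H_λ` as checkerboard matrices -/

section Composition

variable {m : ℕ} (c : Composition m)

lemma colStrip_castSucc (j : Fin m) : colStrip c j.castSucc = (c.index j : ℕ) + 1 := by
  simp [colStrip]

lemma colStrip_last : colStrip c (Fin.last m) = c.length + 1 := by
  simp [colStrip]

/-- The identity blocks lie along the subdiagonal; this is why row `j + 1` inherits the letter of
column `j`. -/
lemma rowStrip_succ (j : Fin m) : rowStrip c j.succ = colStrip c j.castSucc := by
  rw [colStrip_castSucc]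
  rfl

lemma colStrip_mono : Monotone (colStrip c) := by
  intro i j hij
  refine Fin.lastCases (fun hij => ?_) (fun j hij => ?_) j hij
  · refine Fin.lastCases le_rfl (fun i => ?_) i
    rw [colStrip_castSucc, colStrip_last]
    exact Nat.succ_le_succ (c.index i).2.le
  · have hi : i ≠ Fin.last m := fun h => (Fin.castSucc_lt_last j).not_ge (h ▸ hij)
    obtain ⟨i, rfl⟩ := Fin.exists_castSucc_eq.2 hi
    rw [colStrip_castSucc, colStrip_castSucc]
    have h1 := c.sizeUpTo_index_le i
    have h2 := c.lt_sizeUpTo_index_succ j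
    have h3 : (i : ℕ) ≤ j := hij
    by_contra! h
    have h4 := c.monotone_sizeUpTo (show (c.index j).succ.val ≤ c.index i by simp; omega)
    omega

lemma word_eq_bodd_colStrip (j : Fin (m + 1)) :
    (word true c.blocks).getD j false = (colStrip c j).bodd := by
  refine Fin.lastCases ?_ (fun j => ?_) j
  · have := word_getD_sum true c.blocks
    rw [c.blocks_sum] at this
    rw [colStrip_last, Fin.val_last, this, Nat.bodd_succ, Bool.true_xor]
  · rw [colStrip_castSucc, Fin.val_castSucc, word_getD true c.blocks (c.index j) j
      (c.sizeUpTo_index_le j) (c.lt_sizeUpTo_index_succ j), Nat.bodd_succ, Bool.true_xor]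

/-- A letter is the parity of a strip number, so a block above the identity blocks is all ones iff
its letters differ. Inside an identity block the letters agree, and only the subdiagonal ones
remain. -/
lemma Hlam_eq_checkerboard :
    Hlam c = checkerboard (m + 1) false fun j => (word true c.blocks).getD j false := by
  ext i j
  simp only [Hlam, checkerboard, Matrix.of_apply]
  simp only [word_eq_bodd_colStrip]
  refine Fin.cases ?_ (fun i => ?_) i
  · have hpos : 0 < colStrip c j := by
      refine Fin.lastCases ?_ (fun j => ?_) j
      · simp [colStrip_last]
      · simp [colStrip_castSucc]
    have h0 : rowStrip c 0 = 0 := rfl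
    simp [h0, hpos, hpos.ne, prev, odd_iff_bodd]
  · have hprev : prev false (fun j => (word true c.blocks).getD j false) (i.succ : Fin (m + 1))
        = (colStrip c i.castSucc).bodd := word_eq_bodd_colStrip c i.castSucc
    rw [hprev, rowStrip_succ]
    have hval : ((i.succ : Fin (m + 1)) : ℕ) = i + 1 := rfl
    rw [hval]
    rcases lt_trichotomy (i : ℕ) j with h | h | h
    · have hle : colStrip c i.castSucc ≤ colStrip c j := colStrip_mono c (Fin.le_def.2 h.le)
      have hodd : Odd (colStrip c j - colStrip c i.castSucc) ↔
          (colStrip c j).bodd ≠ (colStrip c i.castSucc).bodd := by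
        obtain ⟨d, hd⟩ := Nat.exists_eq_add_of_le hle
        rw [hd, Nat.add_sub_cancel_left, odd_iff_bodd, Nat.bodd_add]
        cases (colStrip c i.castSucc).bodd <;> cases d.bodd <;> simp
      by_cases heq : colStrip c i.castSucc = colStrip c j
      · simp [heq, h.ne]
      · simp [heq, lt_of_le_of_ne hle heq, h.ne, hodd, Nat.succ_le_of_lt h]
    · obtain rfl : i.castSucc = j := Fin.ext h
      simp
    · have hle : colStrip c j ≤ colStrip c i.castSucc := colStrip_mono c (Fin.le_def.2 h.le)
      by_cases heq : colStrip c i.castSucc = colStrip c j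
      · simp [heq, h.ne', h.not_gt]
      · simp [heq, hle.not_gt, h.ne', h.not_gt]

end Composition

/-! ### Determinants of checkerboard matrices -/

/-- The absolute value of the determinant of the checkerboard matrix with top letter `b` of a
nonempty word. -/
def absDet (b : Bool) : List Bool → ℕ
  | [] => 0
  | [x] => if x = b then 0 else 1
  | x :: y :: w => absDet b (y :: w) + if x = b then 0 else absDet (!b) (y :: w)

lemma checkerboard_submatrix_zero (n : ℕ) (b : Bool) (h : ℕ → Bool) :
    (checkerboard (n + 1) b h).submatrix (Fin.succAbove 0) Fin.succ
      = checkerboard n (h 0) fun j => h (j + 1) := by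
  ext i j
  have hp : prev b h (i + 1) = prev (h 0) (fun j => h (j + 1)) i := by
    cases (i : ℕ) <;> simp [prev]
  simp only [Matrix.submatrix_apply, checkerboard, Matrix.of_apply, Fin.succAbove_zero,
    Fin.val_succ, hp, Nat.add_right_cancel_iff, Nat.add_le_add_iff_right]

lemma checkerboard_submatrix_one (n : ℕ) (b : Bool) (h : ℕ → Bool) :
    (checkerboard (n + 2) b h).submatrix (Fin.succAbove 1) Fin.succ
      = checkerboard (n + 1) b fun j => h (j + 1) := by
  ext i j
  refine Fin.cases ?_ (fun i => ?_) i
  · simp [checkerboard, prev, Fin.succAbove]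
  · have h1 : (Fin.succAbove 1 i.succ : Fin (n + 2)) = i.succ.succ := by
      simp [Fin.succAbove, Fin.lt_def]
    have hp : prev b h (i + 1 + 1) = prev b (fun j => h (j + 1)) (i + 1) := rfl
    simp only [Matrix.submatrix_apply, checkerboard, Matrix.of_apply, h1, Fin.val_succ, hp,
      Nat.add_right_cancel_iff, Nat.add_le_add_iff_right]

/-- The first column vanishes below row 1. Deleting row 0 promotes the row with letter `h 0` to the
top, deleting row 1 keeps the top letter `b`. -/
lemma det_checkerboard_succ (n : ℕ) (b : Bool) (h : ℕ → Bool) :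
    (checkerboard (n + 2) b h).det =
      (if h 0 = b then 0 else (checkerboard (n + 1) (!b) fun j => h (j + 1)).det)
        - (checkerboard (n + 1) b fun j => h (j + 1)).det := by
  rw [Matrix.det_succ_column_zero, Fin.sum_univ_succ, Fin.sum_univ_succ,
    Finset.sum_eq_zero fun i _ => ?_]
  · rw [checkerboard_submatrix_zero, Fin.succ_zero_eq_one, checkerboard_submatrix_one]
    by_cases hb : h 0 = b
    · simp [checkerboard, prev, hb]
    · rw [Bool.eq_not_of_ne hb]
      simp [checkerboard, prev, hb, sub_eq_add_neg]
  · simp [checkerboard]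

/-- For a fixed word the determinants with the two top letters never have the same strict sign, so
the difference in the column expansion adds absolute values. The induction therefore carries one
sign `e` for both letters. -/
lemma det_checkerboard (x : Bool) (w : List Bool) :
    ∃ e : ℝ, |e| = 1 ∧ ∀ b : Bool,
      (checkerboard (w.length + 1) b fun j => (x :: w).getD j false).det
        = e * (if b then 1 else -1) * absDet b (x :: w) := by
  induction w generalizing x with
  | nil =>
    refine ⟨if x then -1 else 1, by cases x <;> simp, fun b => ?_⟩
    rw [show ([] : List Bool).length + 1 = 1 from rfl, Matrix.det_fin_one]
    cases x <;> cases b <;> simp [checkerboard, prev, absDet]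
  | cons y w ih =>
    obtain ⟨e, he, h⟩ := ih y
    refine ⟨-e, by rwa [abs_neg], fun b => ?_⟩
    rw [List.length_cons, det_checkerboard_succ]
    simp only [List.getD_cons_succ, List.getD_cons_zero, h, absDet]
    by_cases hb : x = b
    · cases b <;> simp [hb]
    · cases b <;> simp [hb] <;> ring

/-- Numerator and denominator of the finite continued fraction, from the Euclidean recursion. -/
def contFracPair : List ℕ → ℕ × ℕ
  | [] => (1, 0)
  | a :: l => (a * (contFracPair l).1 + (contFracPair l).2, (contFracPair l).1)

/-- Each letter `b` put in front keeps the value for top letter `b` and adds it to the other one: a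
Euclidean step in unary. -/
lemma absDet_replicate_append (a : ℕ) (b : Bool) {w : List Bool} (hw : w ≠ []) :
    absDet b (List.replicate a b ++ w) = absDet b w ∧
      absDet (!b) (List.replicate a b ++ w) = absDet (!b) w + a * absDet b w := by
  induction a with
  | zero => simp
  | succ a ih =>
    obtain ⟨y, v, hv⟩ := List.exists_cons_of_ne_nil
      (show List.replicate a b ++ w ≠ [] by simp [hw])
    rw [hv] at ih
    rw [List.replicate_succ, List.cons_append, hv, absDet, absDet, ih.1, ih.2]
    cases b <;> simp [ih.1] <;> ring

/-- The next run has the opposite letter, so the two values change roles, exactly as in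
`contFracPair`. The closing letter gives the initial pair `(1, 0)`. -/
lemma absDet_word (b : Bool) (l : List ℕ) :
    absDet (!b) (word b l) = (contFracPair l).1 ∧ absDet b (word b l) = (contFracPair l).2 := by
  induction l generalizing b with
  | nil => simp [word, absDet, contFracPair]
  | cons a l ih =>
    have h1 := absDet_replicate_append a b (word_ne_nil (!b) l)
    have h2 := ih (!b)
    rw [Bool.not_not] at h2
    rw [word, h1.1, h1.2, h2.1, h2.2, contFracPair]
    exact ⟨add_comm _ _, rfl⟩

lemma abs_det_Hlam {m : ℕ} (c : Composition m) :
    |(Hlam c).det| = (contFracPair c.blocks).1 := by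
  obtain ⟨x, w, hw⟩ := List.exists_cons_of_ne_nil (word_ne_nil true c.blocks)
  have hlen := length_word true c.blocks
  rw [c.blocks_sum, hw, List.length_cons] at hlen
  obtain ⟨e, he, h⟩ := det_checkerboard x w
  have h1 := (absDet_word true c.blocks).1
  rw [Hlam_eq_checkerboard, ← hlen, ← h1, hw, h]
  simp [abs_mul, he]

/-! ### Continued fractions -/

lemma contFracPair_fst_pos {l : List ℕ} (hl : ∀ a ∈ l, 0 < a) : 0 < (contFracPair l).1 := by
  induction l with
  | nil => simp [contFracPair]
  | cons a l ih =>
    have h1 := ih fun x hx => hl x (List.mem_cons_of_mem a hx)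
    have h2 := hl a List.mem_cons_self
    exact Nat.add_pos_left (Nat.mul_pos h2 h1) _

lemma contFracPair_coprime (l : List ℕ) :
    Nat.Coprime (contFracPair l).1 (contFracPair l).2 := by
  induction l with
  | nil => simp [contFracPair]
  | cons a l ih => simpa [contFracPair] using ih.symm

lemma contFrac_eq {a : ℕ} {l : List ℕ} (hl : ∀ x ∈ a :: l, 0 < x) :
    contFrac (a :: l) = ((contFracPair (a :: l)).1 : ℚ) / (contFracPair (a :: l)).2 := by
  induction l generalizing a with
  | nil => simp [contFrac, contFracPair]
  | cons b l ih =>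
    have hl' : ∀ x ∈ b :: l, 0 < x := fun x hx => hl x (List.mem_cons_of_mem a hx)
    have hpos := contFracPair_fst_pos hl'
    rw [contFrac, ih hl', one_div_div]
    change _ = ((a * (contFracPair (b :: l)).1 + (contFracPair (b :: l)).2 : ℕ) : ℚ)
      / (contFracPair (b :: l)).1
    have : ((contFracPair (b :: l)).1 : ℚ) ≠ 0 := by positivity
    push_cast
    field_simp

lemma contFrac_num {l : List ℕ} (hne : l ≠ []) (hl : ∀ a ∈ l, 0 < a) :
    (contFrac l).num = (contFracPair l).1 := by
  obtain ⟨a, l, rfl⟩ := List.exists_cons_of_ne_nil hne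
  have hpos := contFracPair_fst_pos fun x hx => hl x (List.mem_cons_of_mem a hx)
  rw [contFrac_eq hl]
  have := Rat.num_div_eq_of_coprime (a := ((contFracPair (a :: l)).1 : ℤ))
    (b := ((contFracPair (a :: l)).2 : ℤ)) (Int.natCast_pos.2 hpos)
    (by simpa using contFracPair_coprime (a :: l))
  simpa using this

/-! ### Kepler's tree -/

/-- The list with its first entry increased by one. -/
def incHead : List ℕ → List ℕ
  | [] => []
  | a :: l => (a + 1) :: l

/-- The positive lists with sum `k + 2` and last entry at least `2`, in the order of the vertices
of level `k` of Kepler's tree. -/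
def keplerBlocks : ℕ → List (List ℕ)
  | 0 => [[2]]
  | k + 1 => (keplerBlocks k).flatMap fun l => [incHead l, 1 :: l]

/-- The first entry tells which move came last: a 1 was put in front, a larger entry was raised. The
bound on the last entry excludes `[1]`, so the descent ends at `[2]`. -/
lemma mem_keplerBlocks {k : ℕ} {l : List ℕ} :
    l ∈ keplerBlocks k ↔ (∀ a ∈ l, 0 < a) ∧ l.sum = k + 2 ∧ 2 ≤ l.getLastD 0 := by
  induction k generalizing l with
  | zero =>
    rw [keplerBlocks, List.mem_singleton]
    constructor
    · rintro rfl
      simp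
    · rintro ⟨hpos, hsum, hlast⟩
      match l with
      | [] => simp at hsum
      | [a] => simpa using hsum
      | a :: b :: l =>
        have ha := hpos a (by simp)
        have hle : (b :: l).getLastD 0 ≤ (b :: l).sum := by
          refine List.le_sum_of_mem ?_
          rw [List.getLastD_cons]
          exact List.getLastD_mem_cons
        simp only [List.getLastD_cons] at hle hlast
        rw [List.sum_cons] at hsum
        omega
  | succ k ih =>
    simp only [keplerBlocks, List.mem_flatMap, List.mem_cons, List.not_mem_nil, or_false]
    constructor
    · rintro ⟨l', hl', rfl | rfl⟩
      · obtain ⟨hpos, hsum, hlast⟩ := ih.1 hl'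
        match l' with
        | [] => simp at hsum
        | a :: t =>
          refine ⟨fun x hx => ?_, ?_, ?_⟩
          · rcases List.mem_cons.1 hx with rfl | hx
            · omega
            · exact hpos x (List.mem_cons_of_mem _ hx)
          · simp [incHead] at hsum ⊢
            omega
          · cases t <;> simp [incHead] at hlast ⊢ <;> omega
      · obtain ⟨hpos, hsum, hlast⟩ := ih.1 hl'
        refine ⟨by simpa using hpos, by rw [List.sum_cons, hsum]; ring, ?_⟩
        cases l' <;> simp at hlast ⊢; omega
    · rintro ⟨hpos, hsum, hlast⟩
      match l with
      | [] => simp at hsum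
      | 1 :: t =>
        refine ⟨t, ih.2 ⟨fun x hx => hpos x (List.mem_cons_of_mem _ hx), ?_, ?_⟩, Or.inr rfl⟩
        · rw [List.sum_cons] at hsum
          omega
        · cases t <;> simp at hlast ⊢; omega
      | 0 :: t => exact absurd (hpos 0 (by simp)) (lt_irrefl 0)
      | (a + 2) :: t =>
        refine ⟨(a + 1) :: t, ih.2 ⟨fun x hx => ?_, ?_, ?_⟩, Or.inl rfl⟩
        · rcases List.mem_cons.1 hx with rfl | hx
          · omega
          · exact hpos x (List.mem_cons_of_mem _ hx)
        · rw [List.sum_cons] at hsum ⊢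
          omega
        · cases t
          · simp at hsum ⊢
            omega
          · simpa using hlast

lemma incHead_inj {l l' : List ℕ} (h : incHead l = incHead l') : l = l' := by
  cases l <;> cases l' <;> simp_all [incHead]

lemma nodup_keplerBlocks (k : ℕ) : (keplerBlocks k).Nodup := by
  induction k with
  | zero => simp [keplerBlocks]
  | succ k ih =>
    have hne : ∀ l ∈ keplerBlocks k, ∀ l', incHead l ≠ 1 :: l' := by
      intro l hl l' h
      have hpos := (mem_keplerBlocks.1 hl).1
      cases l with
      | nil => simp [incHead] at h
      | cons a l =>
        have := hpos a (by simp)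
        simp [incHead] at h
        omega
    rw [keplerBlocks, List.nodup_flatMap]
    refine ⟨fun l hl => by simpa using hne l hl l, ?_⟩
    refine ih.imp_of_mem fun {l l'} hl hl' hll' => ?_
    simp only [Function.onFun, List.disjoint_cons_left, List.mem_cons, List.not_mem_nil, or_false,
      not_or, List.disjoint_nil_left, and_true]
    exact ⟨⟨fun h => hll' (incHead_inj h), hne l hl l'⟩, fun h => hne l' hl' l h.symm,
      fun h => hll' (List.cons_injective h)⟩

/-- If `l` has value `q / p`, raising its head gives `(p + q) / p` and prefixing 1 gives `(p + q) /
q`, the inverses of the children of `p / q`. -/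
lemma keplerLevel_eq (k : ℕ) :
    keplerLevel k = (keplerBlocks k).map fun l => ((contFracPair l).2, (contFracPair l).1) := by
  induction k with
  | zero => simp [keplerLevel, keplerBlocks, contFracPair]
  | succ k ih =>
    rw [keplerLevel, keplerBlocks, ih, List.flatMap_map, List.map_flatMap]
    refine List.flatMap_congr fun l hl => ?_
    cases l with
    | nil => simpa using (mem_keplerBlocks.1 hl).2.1
    | cons a l => simp [incHead, contFracPair]; ring_nf; trivial

/-- Since the first part is at least 2, it can be lowered by one, which leaves only the condition on
the last part. The same unit turns the numerator `q` into `p + q`. -/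
lemma admissible_blocks (k : ℕ) :
    (Finset.univ.filter fun c : Composition (k + 3) => Admissible c).val.map
      (fun c => c.blocks) = ((keplerBlocks k).map incHead : Multiset (List ℕ)) := by
  refine (Multiset.Nodup.ext ?_ ?_).2 fun l => ?_
  · exact Multiset.Nodup.map (fun c c' h => Composition.ext h) (Finset.nodup _)
  · exact Multiset.coe_nodup.2 ((nodup_keplerBlocks k).map fun _ _ => incHead_inj)
  · simp only [Multiset.mem_map, Finset.mem_val, Finset.mem_filter, Finset.mem_univ, true_and,
      Multiset.mem_coe, List.mem_map]
    constructor
    · rintro ⟨c, ⟨hhead, hlast⟩, rfl⟩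
      have hpos : ∀ a ∈ c.blocks, 0 < a := fun a ha => c.blocks_pos ha
      have hsum := c.blocks_sum
      match hb : c.blocks with
      | [] => simp [hb] at hhead
      | 0 :: t => simp [hb] at hhead
      | (a + 1) :: t =>
        rw [hb] at hhead hlast hpos hsum
        have ha : 0 < a := by simpa [Nat.succ_le_iff] using hhead
        refine ⟨a :: t, mem_keplerBlocks.2 ⟨fun x hx => ?_, ?_, ?_⟩, rfl⟩
        · rcases List.mem_cons.1 hx with rfl | hx
          · exact ha
          · exact hpos x (List.mem_cons_of_mem _ hx)
        · rw [List.sum_cons] at hsum ⊢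
          omega
        · cases t
          · simp at hsum ⊢
            omega
          · simpa using hlast
    · rintro ⟨l', hl', rfl⟩
      obtain ⟨hpos, hsum, hlast⟩ := mem_keplerBlocks.1 hl'
      match l' with
      | [] => simp at hsum
      | a :: t =>
        have ha := hpos a (by simp)
        refine ⟨⟨(a + 1) :: t, fun {x} hx => ?_, ?_⟩, ⟨?_, ?_⟩, rfl⟩
        · rcases List.mem_cons.1 hx with rfl | hx
          · omega
          · exact hpos x (List.mem_cons_of_mem _ hx)
        · rw [List.sum_cons] at hsum ⊢
          omega
        · simpa [Nat.succ_le_iff] using ha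
        · cases t <;> simp at hlast ⊢ <;> omega

lemma abs_det_eq_kepler (k : ℕ) :
    ((Finset.univ.filter fun c : Composition (k + 3) => Admissible c).val.map
      fun c => |(Hlam c).det|) =
    ((keplerLevel k : Multiset (ℕ × ℕ)).map fun v => ((v.1 + v.2 : ℕ) : ℝ)) := by
  have h1 : ((Finset.univ.filter fun c : Composition (k + 3) => Admissible c).val.map
      fun c => |(Hlam c).det|) = ((Finset.univ.filter fun c : Composition (k + 3) =>
        Admissible c).val.map fun c => c.blocks).map fun l => ((contFracPair l).1 : ℝ) := by
    rw [Multiset.map_map]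
    exact Multiset.map_congr rfl fun c _ => abs_det_Hlam c
  rw [h1, admissible_blocks, keplerLevel_eq, Multiset.map_coe, Multiset.map_coe, List.map_map,
    List.map_map]
  refine congrArg _ (List.map_congr_left fun l hl => ?_)
  cases l with
  | nil => simpa using (mem_keplerBlocks.1 hl).2.1
  | cons a l => simp [incHead, contFracPair]; ring

/-! ### Shape of checkerboard matrices -/

lemma isZeroOne_checkerboard (n : ℕ) (b : Bool) (h : ℕ → Bool) :
    IsZeroOne (checkerboard n b h) := by
  intro i j
  simp only [checkerboard, Matrix.of_apply]
  split_ifs <;> simp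

lemma isUnreducedUpperHessenberg_checkerboard (n : ℕ) (b : Bool) (h : ℕ → Bool) :
    IsUnreducedUpperHessenberg (checkerboard n b h) := by
  refine ⟨fun i j hij => ?_, fun i j hij => by simp [checkerboard, hij]⟩
  rw [checkerboard, Matrix.of_apply, if_neg (by omega), if_neg (by omega)]

/-! ### Gramians of checkerboard matrices -/

section Gram

variable {m : ℕ} {h : ℕ → Bool}

/-- The number of entries `1` on and above the diagonal in a column of a checkerboard matrix of
size `m + 1`. -/
def upperCount (m : ℕ) (h : ℕ → Bool) (i : ℕ) : ℝ :=
  ∑ r ∈ Finset.range (m + 1), if r ≤ i ∧ h i ≠ prev false h r then 1 else 0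

lemma gram_apply (i j : Fin (m + 1)) :
    ((checkerboard (m + 1) false h)ᵀ * checkerboard (m + 1) false h) i j =
      ∑ r ∈ Finset.range (m + 1),
        (if r = i + 1 then 1 else if r ≤ (i : ℕ) ∧ h i ≠ prev false h r then 1 else 0) *
        (if r = j + 1 then 1 else if r ≤ (j : ℕ) ∧ h j ≠ prev false h r then (1 : ℝ) else 0) := by
  rw [Finset.sum_range]
  rfl

/-- Equal letters mark the same rows up to row `i`. In row `i + 1`, whose letter is `h i = h j`,
column `j` has a zero. -/
lemma gram_of_eq {i j : Fin (m + 1)} (hij : i < j) (hh : h i = h j) :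
    ((checkerboard (m + 1) false h)ᵀ * checkerboard (m + 1) false h) i j
      = upperCount m h i := by
  rw [gram_apply]
  refine Finset.sum_congr rfl fun r _ => ?_
  have hij' : (i : ℕ) < j := hij
  rcases lt_trichotomy r (i + 1) with hr | rfl | hr
  · simp [hr.ne, show r ≠ j + 1 by omega, show r ≤ (i : ℕ) by omega, show r ≤ (j : ℕ) by omega, hh]
  · simp [hij'.ne, hij', prev, hh]
  · simp [hr.ne', show ¬ r ≤ (i : ℕ) by omega]

/-- Different letters mark complementary rows up to row `i`, so only the subdiagonal one of column
`i` is shared. -/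
lemma gram_of_ne {i j : Fin (m + 1)} (hij : i < j) (hh : h i ≠ h j) :
    ((checkerboard (m + 1) false h)ᵀ * checkerboard (m + 1) false h) i j = 1 := by
  rw [gram_apply]
  have hij' : (i : ℕ) < j := hij
  rw [Finset.sum_eq_single ((i : ℕ) + 1)]
  · simp [hij'.ne, hij', prev, hh.symm]
  · intro r _ hne
    rcases lt_or_gt_of_ne hne with hr | hr
    · by_cases hi : h i = prev false h r
      · simp [hne, hi]
      · have hj : h j = prev false h r := by
          rw [Bool.eq_not_of_ne hh.symm, Bool.eq_not_of_ne hi, Bool.not_not]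
        simp [hj, show r ≠ j + 1 by omega]
    · simp [hne, show ¬ r ≤ (i : ℕ) by omega]
  · intro hi
    rw [Finset.mem_range] at hi
    omega

lemma gram_self (i : Fin (m + 1)) :
    ((checkerboard (m + 1) false h)ᵀ * checkerboard (m + 1) false h) i i
      = (if (i : ℕ) < m then 1 else 0) + upperCount m h i := by
  have h1 : (if (i : ℕ) < m then (1 : ℝ) else 0)
      = ∑ r ∈ Finset.range (m + 1), if r = (i : ℕ) + 1 then 1 else 0 := by
    rw [Finset.sum_ite_eq']
    simp
  rw [gram_apply, upperCount, h1, ← Finset.sum_add_distrib]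
  refine Finset.sum_congr rfl fun r _ => ?_
  by_cases hr : r = i + 1
  · simp [hr]
  · simp [hr]

lemma upperCount_mono {i j : ℕ} (hij : i ≤ j) (hh : h i = h j) :
    upperCount m h i ≤ upperCount m h j := by
  refine Finset.sum_le_sum fun r _ => ?_
  rw [hh]
  by_cases hr : r ≤ i
  · simp [hr, hr.trans hij]
  · rw [if_neg fun h => hr h.1]
    split_ifs <;> norm_num

lemma one_le_upperCount (h0 : h 0 = true) {i : ℕ} (hi : i ≤ m) : 1 ≤ upperCount m h i := by
  obtain ⟨r, hr, hne⟩ : ∃ r ≤ i, h i ≠ prev false h r := by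
    cases hb : h i
    · refine ⟨1, ?_, by simp [prev, h0]⟩
      rcases i with _ | i
      · simp [h0] at hb
      · omega
    · exact ⟨0, by omega, by simp [prev]⟩
  have hle : (if r ≤ i ∧ h i ≠ prev false h r then (1 : ℝ) else 0) ≤ upperCount m h i :=
    Finset.single_le_sum (s := Finset.range (m + 1))
    (f := fun r => if r ≤ i ∧ h i ≠ prev false h r then (1 : ℝ) else 0)
    (fun r _ => by split_ifs <;> norm_num) (Finset.mem_range.2 (show r < m + 1 by omega))
  rwa [if_pos ⟨hr, hne⟩] at hle

lemma one_lt_upperCount_last (hm : 2 ≤ m) (h0 : h 0 = true) (h1 : h 1 = true)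
    (hlast : h m ≠ h (m - 1)) : 1 < upperCount m h m := by
  obtain ⟨a, b, hab, ha, hb, hna, hnb⟩ : ∃ a b, a ≠ b ∧ a ≤ m ∧ b ≤ m ∧
      h m ≠ prev false h a ∧ h m ≠ prev false h b := by
    cases hb : h m
    · exact ⟨1, 2, by omega, by omega, hm, by simp [prev, h0], by simp [prev, h1]⟩
    · obtain ⟨r, rfl⟩ := Nat.exists_eq_add_of_le' (show 1 ≤ m by omega)
      -- Row `m = r + 1` carries the letter of column `m - 1`, which differs from `h m`.
      exact ⟨0, r + 1, by omega, by omega, le_rfl, by simp [prev], hb ▸ hlast⟩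
  have hone : ∑ r ∈ Finset.range (m + 1), (if r = a then (1 : ℝ) else 0) = 1 := by
    rw [Finset.sum_ite_eq', if_pos (Finset.mem_range.2 (by omega))]
  rw [← hone]
  refine Finset.sum_lt_sum (fun r _ => ?_) ⟨b, Finset.mem_range.2 (by omega), ?_⟩
  · by_cases hr : r = a
    · simp [hr, ha, hna]
    · rw [if_neg hr]
      split_ifs <;> norm_num
  · rw [if_neg hab.symm, if_pos ⟨hb, hnb⟩]
    exact one_pos

lemma upperCount_lt_last (hlast : h m ≠ h (m - 1)) {j : ℕ} (hj : j < m) (hh : h j = h m) :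
    upperCount m h j < upperCount m h m := by
  refine Finset.sum_lt_sum (fun r _ => ?_) ⟨m, by simp, ?_⟩
  · rw [hh]
    by_cases hr : r ≤ j
    · simp [hr, hr.trans hj.le]
    · rw [if_neg fun h => hr h.1]
      split_ifs <;> norm_num
  · obtain ⟨r, rfl⟩ := Nat.exists_eq_add_of_le' (show 1 ≤ m by omega)
    rw [if_neg fun h => hj.not_ge h.1, if_pos ⟨le_rfl, hlast⟩]
    exact one_pos

/-- Across letters the entry is the minimal value 1; within a letter class it is a monotone function
of the smaller index, which is ultrametric. The subdiagonal one makes the diagonal strictly larger,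
except in the last column, where `h1` and `hlast` take over. -/
lemma isStrictlyUltrametric_gram_checkerboard (hm : 2 ≤ m) (h0 : h 0 = true) (h1 : h 1 = true)
    (hlast : h m ≠ h (m - 1)) :
    IsStrictlyUltrametric
      ((checkerboard (m + 1) false h)ᵀ * checkerboard (m + 1) false h) := by
  set G := (checkerboard (m + 1) false h)ᵀ * checkerboard (m + 1) false h with hG
  have hsymm : ∀ i j, G i j = G j i := by
    intro i j
    rw [hG, gram_apply, gram_apply]
    exact Finset.sum_congr rfl fun r _ => mul_comm _ _
  have hne : ∀ i j : Fin (m + 1), h i ≠ h j → G i j = 1 := by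
    intro i j hh
    rcases lt_trichotomy i j with hij | rfl | hij
    · exact gram_of_ne hij hh
    · exact absurd rfl hh
    · rw [hsymm]
      exact gram_of_ne hij hh.symm
  have heq : ∀ i j : Fin (m + 1), i ≠ j → h i = h j → G i j = upperCount m h (min i j) := by
    intro i j hij hh
    rcases lt_or_gt_of_ne hij with hij | hij
    · rw [hG, gram_of_eq hij hh, min_eq_left (Fin.le_def.1 hij.le)]
    · rw [hsymm, hG, gram_of_eq hij hh.symm, min_eq_right (Fin.le_def.1 hij.le)]
  have hself : ∀ i : Fin (m + 1), upperCount m h i ≤ G i i := by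
    intro i
    rw [hG, gram_self]
    split_ifs <;> norm_num
  have hmin : ∀ i j : Fin (m + 1), h i = h j → h (min i j : ℕ) = h i := by
    intro i j hh
    rcases min_choice (i : ℕ) j with hc | hc <;> rw [hc]
    exact hh.symm
  have hone : ∀ i j, 1 ≤ G i j := by
    intro i j
    by_cases hh : h i = h j
    · by_cases hij : i = j
      · rw [hij]
        exact (one_le_upperCount h0 (by omega)).trans (hself j)
      · rw [heq i j hij hh]
        exact one_le_upperCount h0 (by omega)
    · rw [hne i j hh]
  have hdiag : ∀ i j, i ≠ j → G i j < G i i := by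
    intro i j hij
    have hi := one_le_upperCount (m := m) h0 (show (i : ℕ) ≤ m by omega)
    rcases (Nat.lt_succ_iff.1 i.2).lt_or_eq with him | him
    · rw [hG, gram_self, if_pos him, ← hG]
      by_cases hh : h i = h j
      · rw [heq i j hij hh]
        have := upperCount_mono (m := m) (min_le_left (i : ℕ) j) (hmin i j hh)
        linarith
      · rw [hne i j hh]
        linarith
    · have hjm : (j : ℕ) < m := by
        have : (i : ℕ) ≠ j := fun h => hij (Fin.ext h)
        omega
      refine lt_of_lt_of_le ?_ (hself i)
      by_cases hh : h i = h j
      · rw [heq i j hij hh, min_eq_right (by omega), him]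
        exact upperCount_lt_last hlast hjm (by rw [← hh, him])
      · rw [hne i j hh, him]
        exact one_lt_upperCount_last hm h0 h1 hlast
  refine ⟨hsymm, fun i j => one_pos.trans_le (hone i j), fun i j k => ?_, hdiag⟩
  by_cases hik : i = k
  · subst hik
    exact min_le_right _ _
  by_cases hkj : k = j
  · subst hkj
    exact min_le_left _ _
  by_cases hij : i = j
  · subst hij
    exact (min_le_left _ _).trans (hdiag i k hik).le
  by_cases h2 : h i = h k
  · by_cases h3 : h k = h j
    · rw [heq i j hij (h2.trans h3), heq i k hik h2, heq k j hkj h3]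
      rcases le_total (i : ℕ) j with hle | hle
      · refine (min_le_left _ _).trans (upperCount_mono ?_ ?_)
        · omega
        · rw [hmin i k h2, hmin i j (h2.trans h3)]
      · refine (min_le_right _ _).trans (upperCount_mono ?_ ?_)
        · omega
        · rw [hmin k j h3, hmin i j (h2.trans h3), h2]
    · exact (min_le_right _ _).trans ((hne k j h3).le.trans (hone i j))
  · exact (min_le_left _ _).trans ((hne i k h2).le.trans (hone i j))

end Gram

/-- The letters of the checkerboard matrix `H_λ` of an admissible composition. -/
lemma Admissible.word_properties {m : ℕ} {c : Composition m} (hc : Admissible c) :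
    (word true c.blocks).getD 0 false = true ∧ (word true c.blocks).getD 1 false = true ∧
      (word true c.blocks).getD m false ≠ (word true c.blocks).getD (m - 1) false := by
  have hm : 2 ≤ m := by
    have h1 := hc.1
    have h2 := c.blocks_sum
    cases hb : c.blocks with
    | nil => simp [hb] at h1
    | cons a l => simp [hb] at h1 h2; omega
  obtain ⟨r, rfl⟩ := Nat.exists_eq_add_of_le' (show 1 ≤ m by omega)
  refine ⟨?_, ?_, ?_⟩
  · have h1 := hc.1
    cases hb : c.blocks with
    | nil => simp [hb] at h1
    | cons a l =>
      rw [word_getD true (a :: l) 0 0 (by simp) (by simp [hb] at h1 ⊢; omega)]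
      rfl
  · have h1 := hc.1
    cases hb : c.blocks with
    | nil => simp [hb] at h1
    | cons a l =>
      rw [word_getD true (a :: l) 0 1 (by simp) (by simp [hb] at h1 ⊢; omega)]
      rfl
  · have h1 := word_eq_bodd_colStrip c (Fin.last (r + 1))
    have h2 := word_eq_bodd_colStrip c (Fin.last r).castSucc
    rw [colStrip_last] at h1
    rw [colStrip_castSucc] at h2
    -- The column before the last lies in strip `k`, so its parity differs from that of the closing
    -- strip `k + 1`.
    have h3 : (c.index (Fin.last r) : ℕ) + 1 = c.length := by
      have h4 := c.lt_sizeUpTo_index_succ (Fin.last r)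
      by_contra hne
      have h5 : ((c.index (Fin.last r)).succ : ℕ) < c.length :=
        lt_of_le_of_ne (c.index (Fin.last r)).2 hne
      have h6 := c.sizeUpTo_strict_mono h5
      have h7 := c.sizeUpTo_le (((c.index (Fin.last r)).succ : ℕ) + 1)
      rw [Fin.val_last] at h4
      omega
    rw [h3] at h2
    rw [Fin.val_last] at h1
    rw [Fin.val_castSucc, Fin.val_last] at h2
    rw [Nat.add_sub_cancel, h1, h2, Nat.bodd_succ]
    cases c.length.bodd <;> simp

/-! ### Unreduced upper Hessenberg `0/1`-matrices with intersecting, incomparable columns -/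

/-- Unreduced upper Hessenberg `0/1`-matrices the columns of which are the indicator functions of
sets that intersect pairwise but are not contained in each other. -/
structure IsSpernerHessenberg {n : ℕ} (H : Matrix (Fin n) (Fin n) ℝ) : Prop where
  zeroOne : IsZeroOne H
  hessenberg : IsUnreducedUpperHessenberg H
  inter : ∀ i j, i ≠ j → ∃ r, H r i = 1 ∧ H r j = 1
  incomp : ∀ i j, i ≠ j → ∃ r, H r i = 1 ∧ H r j ≠ 1

/-- For 0/1 columns a Gram entry counts common ones: it is 0 for disjoint columns and equals the
diagonal entry under containment. -/
lemma RepresentsAcuteSimplex.isSpernerHessenberg {n : ℕ} [NeZero n]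
    {H : Matrix (Fin n) (Fin n) ℝ} (hH : RepresentsAcuteSimplex H) (h01 : IsZeroOne H)
    (hhess : IsUnreducedUpperHessenberg H) : IsSpernerHessenberg H := by
  refine ⟨h01, hhess, fun i j hij => ?_, fun i j hij => ?_⟩
  · by_contra! hne
    refine (hH.gram hij).1.ne' ?_
    rw [Matrix.mul_apply]
    refine Finset.sum_eq_zero fun r _ => ?_
    rw [Matrix.transpose_apply]
    rcases h01 r i with h | h
    · rw [h, zero_mul]
    · rw [(h01 r j).resolve_right (hne r h), mul_zero]
  · by_contra! hsub
    refine (hH.gram hij).2.ne ?_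
    rw [Matrix.mul_apply, Matrix.mul_apply]
    refine Finset.sum_congr rfl fun r _ => ?_
    rw [Matrix.transpose_apply]
    rcases h01 r i with h | h
    · rw [h, zero_mul, zero_mul]
    · rw [h, hsub r h]

section Sperner

variable {m : ℕ} {H : Matrix (Fin (m + 1)) (Fin (m + 1)) ℝ}

open Classical in
/-- The first row of a `0/1`-matrix as a word. -/
def firstRow (H : Matrix (Fin (m + 1)) (Fin (m + 1)) ℝ) (j : ℕ) : Bool :=
  decide (H 0 (Fin.ofNat (m + 1) j) = 1)

lemma firstRow_val (H : Matrix (Fin (m + 1)) (Fin (m + 1)) ℝ) (j : Fin (m + 1)) :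
    firstRow H j = true ↔ H 0 j = 1 := by
  simp [firstRow]

/-- The entries on and above the diagonal are determined by the first row. -/
lemma IsSpernerHessenberg.apply_eq_one_iff (hH : IsSpernerHessenberg H) :
    ∀ i j : Fin (m + 1), i ≤ j → (H i j = 1 ↔ firstRow H j ≠ prev false (firstRow H) i) := by
  intro i
  induction i using WellFoundedLT.induction with
  | _ i ih =>
    intro j hij
    obtain rfl | ⟨k, rfl⟩ := Fin.eq_zero_or_eq_succ i
    · rw [← firstRow_val]
      simp [prev]
    have hprev : prev false (firstRow H) (k.succ : Fin (m + 1)) = firstRow H k.castSucc := rfl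
    have hkj : k.castSucc ≠ j := fun h => by
      rw [← h] at hij
      exact hij.not_gt (Fin.castSucc_lt_succ)
    -- Column `j` is compared with column `k`, whose ones lie in row `k + 1` and above it, where
    -- induction applies to both columns.
    have hcol : ∀ r, H r k.castSucc = 1 → r ≠ k.succ →
        (H r k.castSucc = 1 ↔ firstRow H k.castSucc ≠ prev false (firstRow H) r) ∧
        (H r j = 1 ↔ firstRow H j ≠ prev false (firstRow H) r) := by
      intro r hr hne
      have hr' : (r : ℕ) ≤ k := by
        by_contra! hlt
        have : (r : ℕ) ≠ k + 1 := fun h => hne (Fin.ext h)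
        have h0 := hH.hessenberg.1 r k.castSucc (by rw [Fin.val_castSucc]; omega)
        rw [h0] at hr
        exact zero_ne_one hr
      have hlt : r < k.succ := Fin.lt_def.2 (Nat.lt_succ_of_le hr')
      exact ⟨ih r hlt _ (Fin.le_def.2 hr'), ih r hlt _ (hlt.le.trans hij)⟩
    rw [hprev]
    constructor
    -- With equal letters, a one in row `k + 1` of column `j` would put column `k` inside column
    -- `j`.
    · intro h1 heq
      obtain ⟨r, hr, hr'⟩ := hH.incomp _ _ hkj
      obtain ⟨h2, h3⟩ := hcol r hr fun h => hr' (h ▸ h1)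
      exact hr' (h3.2 (by rw [heq]; exact h2.1 hr))
    -- With different letters the columns are disjoint above row `k + 1`, so they must meet there.
    · intro hne
      obtain ⟨r, hr, hr'⟩ := hH.inter _ _ hkj
      by_cases hrk : r = k.succ
      · rwa [← hrk]
      · obtain ⟨h2, h3⟩ := hcol r hr hrk
        rw [h2] at hr
        rw [h3] at hr'
        exact absurd (by rw [Bool.eq_not_of_ne hr, Bool.eq_not_of_ne hr']) hne

lemma IsSpernerHessenberg.eq_checkerboard (hH : IsSpernerHessenberg H) :
    H = checkerboard (m + 1) false (firstRow H) := by
  ext i j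
  rw [checkerboard, Matrix.of_apply]
  rcases lt_trichotomy (i : ℕ) (j + 1) with h | h | h
  · have hij : (i : ℕ) ≤ j := by omega
    rw [if_neg h.ne]
    by_cases h1 : H i j = 1
    · rw [h1, if_pos ⟨hij, (hH.apply_eq_one_iff i j hij).1 h1⟩]
    · rw [(hH.zeroOne i j).resolve_right h1,
        if_neg fun h => h1 ((hH.apply_eq_one_iff i j hij).2 h.2)]
  · rw [if_pos h]
    exact (hH.zeroOne i j).resolve_left (hH.hessenberg.2 i j h)
  · rw [if_neg h.ne', if_neg (by omega)]
    exact hH.hessenberg.1 i j h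

/-- Otherwise the first column has its only one in row 1 and is contained in every column that it
meets. -/
lemma IsSpernerHessenberg.firstRow_zero (hH : IsSpernerHessenberg H) (hm : 1 ≤ m) :
    firstRow H 0 = true := by
  have h0 : (0 : Fin (m + 1)) ≠ Fin.last m := fun h => by
    have := congrArg Fin.val h
    simp at this
    omega
  refine (firstRow_val H 0).2 ?_
  by_contra hne
  have hone : ∀ r : Fin (m + 1), H r 0 = 1 → (r : ℕ) = 1 := by
    intro r hr
    have h1 : r ≠ 0 := fun h => hne (h ▸ hr)
    have h2 : (r : ℕ) ≠ 0 := fun h => h1 (Fin.ext h)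
    by_contra h3
    rw [hH.hessenberg.1 r 0 (by rw [Fin.val_zero]; omega)] at hr
    exact zero_ne_one hr
  obtain ⟨r, hr, hr'⟩ := hH.inter _ _ h0
  obtain ⟨s, hs, hs'⟩ := hH.incomp _ _ h0
  obtain rfl : r = s := Fin.ext ((hone r hr).trans (hone s hs).symm)
  exact hs' hr'

/-- With equal letters the last two columns agree above the bottom row, and the last has a zero
there, so it is contained in its neighbour. -/
lemma IsSpernerHessenberg.firstRow_last_ne (hH : IsSpernerHessenberg H) {r : ℕ}
    (hr : m = r + 1) : firstRow H m ≠ firstRow H r := by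
  subst hr
  intro heq
  have hne : Fin.last (r + 1) ≠ (Fin.last r).castSucc := (Fin.castSucc_lt_last _).ne'
  obtain ⟨s, hs, hs'⟩ := hH.incomp _ _ hne
  rw [hH.apply_eq_one_iff s _ (Fin.le_last s), Fin.val_last] at hs
  by_cases hlast : s = Fin.last (r + 1)
  · rw [hlast] at hs
    exact hs heq
  · have hle : s ≤ (Fin.last r).castSucc := by
      have : (s : ℕ) ≠ r + 1 := fun h => hlast (Fin.ext h)
      rw [Fin.le_def, Fin.val_castSucc, Fin.val_last]
      omega
    refine hs' ((hH.apply_eq_one_iff s _ hle).2 ?_)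
    rw [Fin.val_castSucc, Fin.val_last, ← heq]
    exact hs

/-! ### Normalisation by exchanging rows and columns -/

lemma IsSpernerHessenberg.submatrix (hH : IsSpernerHessenberg H) (σ τ : Equiv.Perm (Fin (m + 1)))
    (hhess : IsUnreducedUpperHessenberg (H.submatrix σ τ)) :
    IsSpernerHessenberg (H.submatrix σ τ) := by
  refine ⟨fun i j => hH.zeroOne _ _, hhess, fun i j hij => ?_, fun i j hij => ?_⟩
  · obtain ⟨r, hr⟩ := hH.inter (τ i) (τ j) (τ.injective.ne hij)
    exact ⟨σ.symm r, by simpa using hr⟩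
  · obtain ⟨r, hr⟩ := hH.incomp (τ i) (τ j) (τ.injective.ne hij)
    exact ⟨σ.symm r, by simpa using hr⟩

/-- If `H 0 1 = 0`, then `H 1 1 = 1`, because row 1 has the letter `true`. The first column has ones
in both rows, so the exchange keeps the Hessenberg shape. -/
lemma IsSpernerHessenberg.exists_swap_rows (hH : IsSpernerHessenberg H) (hm : 1 ≤ m) :
    ∃ σ : Equiv.Perm (Fin (m + 1)), (σ = 1 ∨ σ = Equiv.swap 0 1) ∧
      IsSpernerHessenberg (H.submatrix σ (1 : Equiv.Perm (Fin (m + 1)))) ∧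
      firstRow (H.submatrix σ (1 : Equiv.Perm (Fin (m + 1)))) 1 = true := by
  by_cases h1 : firstRow H 1 = true
  · exact ⟨1, Or.inl rfl, hH, h1⟩
  have hv1 : ((1 : Fin (m + 1)) : ℕ) = 1 := by
    obtain ⟨r, rfl⟩ := Nat.exists_eq_add_of_le' hm
    rfl
  have h0 := hH.firstRow_zero hm
  have h11 : H 1 1 = 1 := by
    rw [hH.apply_eq_one_iff 1 1 le_rfl, hv1]
    simpa [prev, h0] using h1
  have hfix : ∀ i : Fin (m + 1), 2 ≤ (i : ℕ) → Equiv.swap (0 : Fin (m + 1)) 1 i = i := by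
    intro i hi
    refine Equiv.swap_apply_of_ne_of_ne (fun h => ?_) fun h => ?_
    · rw [h, Fin.val_zero] at hi
      omega
    · rw [h, hv1] at hi
      omega
  refine ⟨Equiv.swap 0 1, Or.inr rfl, hH.submatrix _ _ ⟨fun i j hij => ?_, fun i j hij => ?_⟩, ?_⟩
  · rw [Matrix.submatrix_apply, hfix i (by omega)]
    exact hH.hessenberg.1 i j hij
  · rw [Matrix.submatrix_apply, Equiv.Perm.one_apply]
    by_cases hj : (j : ℕ) = 0
    · obtain rfl : i = 1 := Fin.ext (by rw [hv1, hij, hj])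
      obtain rfl : j = 0 := Fin.ext hj
      rw [Equiv.swap_apply_right, (firstRow_val H 0).1 h0]
      exact one_ne_zero
    · rw [hfix i (by omega)]
      exact hH.hessenberg.2 i j hij
  · have := (firstRow_val (H.submatrix (Equiv.swap 0 1) (1 : Equiv.Perm (Fin (m + 1)))) 1).2
      (by rwa [Matrix.submatrix_apply, Equiv.swap_apply_left])
    rwa [hv1] at this

/-- If the letters at `m - 2` and `m - 1` differ, the letter at `m` equals the one at `m - 2`, and
exchanging the last two columns brings them together. The new subdiagonal entry is `H m m = 1`. -/
lemma IsSpernerHessenberg.exists_swap_columns (hH : IsSpernerHessenberg H) (hm : 2 ≤ m)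
    (h1 : firstRow H 1 = true) :
    ∃ τ : Equiv.Perm (Fin (m + 1)),
      (τ = 1 ∨ τ = Equiv.swap ⟨m - 1, by omega⟩ (Fin.last m)) ∧
      IsSpernerHessenberg (H.submatrix (1 : Equiv.Perm (Fin (m + 1))) τ) ∧
      firstRow (H.submatrix (1 : Equiv.Perm (Fin (m + 1))) τ) 1 = true ∧
      firstRow (H.submatrix (1 : Equiv.Perm (Fin (m + 1))) τ) (m - 2) =
        firstRow (H.submatrix (1 : Equiv.Perm (Fin (m + 1))) τ) (m - 1) := by
  by_cases heq : firstRow H (m - 2) = firstRow H (m - 1)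
  · exact ⟨1, Or.inl rfl, hH, h1, heq⟩
  have h0 := hH.firstRow_zero (by omega)
  -- This keeps column 1, already normalised, out of the exchange.
  have hm3 : 3 ≤ m := by
    rcases hm.lt_or_eq with h | rfl
    · exact h
    · exact absurd (h0.trans h1.symm) heq
  have hlast := hH.firstRow_last_ne (show m = (m - 1) + 1 by omega)
  set a : Fin (m + 1) := ⟨m - 1, by omega⟩ with ha
  set τ := Equiv.swap a (Fin.last m) with hτ
  have hfix : ∀ j : Fin (m + 1), (j : ℕ) < m - 1 → τ j = j := by
    intro j hj
    refine Equiv.swap_apply_of_ne_of_ne (fun h => ?_) fun h => ?_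
    · rw [h] at hj
      exact lt_irrefl _ hj
    · rw [h, Fin.val_last] at hj
      omega
  have hrow : ∀ j : Fin (m + 1),
      firstRow (H.submatrix (1 : Equiv.Perm (Fin (m + 1))) τ) j = firstRow H (τ j) := by
    intro j
    rw [Bool.eq_iff_iff, firstRow_val, firstRow_val]
    rfl
  have hrow' : ∀ j < m - 1,
      firstRow (H.submatrix (1 : Equiv.Perm (Fin (m + 1))) τ) j = firstRow H j := by
    intro j hj
    have := hrow ⟨j, by omega⟩
    rwa [hfix _ hj] at this
  refine ⟨τ, Or.inr rfl, hH.submatrix _ _ ⟨fun i j hij => ?_, fun i j hij => ?_⟩, ?_, ?_⟩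
  · rw [Matrix.submatrix_apply, hfix j (by omega)]
    exact hH.hessenberg.1 i j hij
  · rw [Matrix.submatrix_apply, Equiv.Perm.one_apply]
    by_cases hj : (j : ℕ) < m - 1
    · rw [hfix j hj]
      exact hH.hessenberg.2 i j hij
    · obtain rfl : j = a := Fin.ext (show (j : ℕ) = m - 1 by omega)
      obtain rfl : i = Fin.last m := Fin.ext (show (i : ℕ) = m by omega)
      rw [hτ, Equiv.swap_apply_left, (hH.apply_eq_one_iff _ _ le_rfl).2 ?_]
      · exact one_ne_zero
      · rw [Fin.val_last]
        obtain ⟨r, rfl⟩ := Nat.exists_eq_add_of_le' (show 1 ≤ m by omega)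
        exact hlast
  · rw [hrow' 1 (by omega), h1]
  · have h2 := hrow a
    rw [hτ, Equiv.swap_apply_left, Fin.val_last] at h2
    rw [hrow' (m - 2) (by omega)]
    change _ = firstRow _ (a : ℕ)
    rw [h2, Bool.eq_not_of_ne heq, Bool.eq_not_of_ne hlast]

lemma IsSpernerHessenberg.exists_composition (hH : IsSpernerHessenberg H) (hm : 2 ≤ m) :
    ∃ c : Composition m, Admissible c ∧ EqUpToSwaps H (Hlam c) := by
  obtain ⟨σ, hσ, hH₁, h1⟩ := hH.exists_swap_rows (by omega)
  obtain ⟨τ, hτ, hH₂, h1', h2⟩ := hH₁.exists_swap_columns hm h1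
  have h0 := hH₂.firstRow_zero (by omega)
  obtain ⟨l, hpos, hsum, hget, hhead, hlast⟩ := exists_word m _ fun r => hH₂.firstRow_last_ne
  refine ⟨⟨l, fun {a} ha => hpos a ha, hsum⟩, ⟨hhead hm (h0.trans h1'.symm),
    hlast (m - 2) (by omega) (by rw [h2]; congr 1; omega)⟩, σ, τ, hσ, hτ, ?_⟩
  rw [h0] at hget
  rw [Hlam_eq_checkerboard, checkerboard_congr fun j hj => hget j (Nat.lt_succ_iff.1 hj),
    ← hH₂.eq_checkerboard]
  rfl

end Sperner

end AcuteHessenberg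

end

theorem theorem1p1 (m : ℕ) (hm : 2 ≤ m) :
    -- an unreduced upper Hessenberg 0/1-matrix of size `n = m + 1` that represents an acute simplex
    (∀ H : Matrix (Fin (m + 1)) (Fin (m + 1)) ℝ,
      AcuteHessenberg.IsZeroOne H → AcuteHessenberg.IsUnreducedUpperHessenberg H →
      AcuteHessenberg.RepresentsAcuteSimplex H →
      ∃ c : Composition m, AcuteHessenberg.Admissible c ∧
        AcuteHessenberg.EqUpToSwaps H (AcuteHessenberg.Hlam c)) ∧
    -- determinant as numerator of the continued fraction in lowest terms
    (∀ c : Composition m, AcuteHessenberg.Admissible c →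
      |(AcuteHessenberg.Hlam c).det| = ((AcuteHessenberg.contFrac c.blocks).num : ℝ)) ∧
    -- determinants (with multiplicity) in terms of Kepler's tree of fractions
    (∀ k : ℕ, m = k + 3 →
      ((Finset.univ.filter fun c : Composition m => AcuteHessenberg.Admissible c).val.map
        fun c => |(AcuteHessenberg.Hlam c).det|) =
      ((AcuteHessenberg.keplerLevel k : Multiset (ℕ × ℕ)).map
        fun v => ((v.1 + v.2 : ℕ) : ℝ))) ∧
    -- converse
    (∀ c : Composition m, AcuteHessenberg.Admissible c →
      AcuteHessenberg.IsZeroOne (AcuteHessenberg.Hlam c) ∧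
      AcuteHessenberg.IsUnreducedUpperHessenberg (AcuteHessenberg.Hlam c) ∧
      AcuteHessenberg.IsStrictlyUltrametric
        ((AcuteHessenberg.Hlam c)ᵀ * AcuteHessenberg.Hlam c) ∧
      AcuteHessenberg.RepresentsAcuteSimplex (AcuteHessenberg.Hlam c)) := by
  refine ⟨fun H h01 hhess hacute =>
      (hacute.isSpernerHessenberg h01 hhess).exists_composition hm, fun c hc => ?_, ?_,
    fun c hc => ?_⟩
  · have hne : c.blocks ≠ [] := fun h => by simpa [h] using hc.1
    rw [AcuteHessenberg.abs_det_Hlam,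
      AcuteHessenberg.contFrac_num hne fun a ha => c.blocks_pos ha]
    simp
  · rintro k rfl
    exact AcuteHessenberg.abs_det_eq_kepler k
  · obtain ⟨h0, h1, hlast⟩ := hc.word_properties
    have hU := AcuteHessenberg.isStrictlyUltrametric_gram_checkerboard
      (h := fun j => (AcuteHessenberg.word true c.blocks).getD j false) hm h0 h1 hlast
    rw [← AcuteHessenberg.Hlam_eq_checkerboard] at hU
    refine ⟨?_, ?_, hU, AcuteHessenberg.representsAcuteSimplex_of_isStrictlyUltrametric hU⟩
    · rw [AcuteHessenberg.Hlam_eq_checkerboard]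
      exact AcuteHessenberg.isZeroOne_checkerboard _ _ _
    · rw [AcuteHessenberg.Hlam_eq_checkerboard]
      exact AcuteHessenberg.isUnreducedUpperHessenberg_checkerboard _ _ _
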